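/- Let $D\subset\mathbb R^d$ be a bounded domain with Lipschitz boundary, and let $(\phi_k)_{k\ge1}$ be an orthonormal basis of $L^2(D)$ consisting of eigenfunctions of $A=-\Delta$ on $D$ with zero Dirichlet boundary condition, with corresponding nondecreasing eigenvalues $(\lambda_k)_{k\ge1}$. Let $\alpha,s,H\in(0,1)$, $T>0$, and let $h\in L^\infty(0,T)$ satisfy $h\ge C_h$ a.e. on $(0,T)$ for some constant $C_h>0$. Put $E_{\alpha,1}(z)=\sum_{j\ge0}z^j/\Gamma(j\alpha+1)$ and $E(t)v=\sum_{k\ge1}E_{\alpha,1}(-\lambda_k^st^\alpha)(v,\phi_k)\phi_k$ for $v\in L^2(D)$. For $f,g\in L^2(D)$ and a fractional Brownian motion $W^H$ with Hurst index $H$ on a probability space, let $$u(t)=\int_0^tE(t-r)f\,h(r)\,dr+\int_0^tE(t-r)g\,dW^H(r),\qquad t\in[0,T],$$ the second term being a Wiener integral with values in $L^2(D)$, be the mild solution of $$\partial_tu+\partial_t^{1-\alpha}A^su=f(x)h(t)+g(x)\dot W^H(t)\ \text{ in }D\times(0,T],\qquad u(\cdot,0)=0,\qquad u=0\text{ on }\partial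 D\times(0,T],$$ where $A^sv=\sum_k\lambda_k^s(v,\phi_k)\phi_k$ and $\partial_t^{1-\alpha}$ is the Riemann--Liouville derivative. Write $u_k(t)=(u(t),\phi_k)_{L^2(D)}$. If $\|g\|_{L^2(D)}\ne0$, then the data $$\{(\mathbb E\,u_k(T),\ \mathrm{Cov}(u_k(T),u_l(T))):k,l\ge1\}$$ determine $f$ uniquely and $g$ uniquely up to sign. That is, if $(f_1,g_1)$ and $(f_2,g_2)$ are two such pairs of sources (with the same $D,(\lambda_k,\phi_k),\alpha,s,H,T,h$; the two fractional Brownian motions may be different and may live on different probability spaces) whose data coincide for all $k,l\ge1$, then $f_1=f_2$, and $g_1=g_2$ or $g_1=-g_2$; in particular $|g_1|=|g_2|$. -/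

import Mathlib

open MeasureTheory ProbabilityTheory Filter Topology
open scoped NNReal ENNReal RealInnerProductSpace

noncomputable section

/-- A bounded domain (non-empty connected open set) of `ℝ^d` with Lipschitz boundary: near each
boundary point, after a rotation taking `ν` to the last axis, `D` is the strict epigraph of a
Lipschitz function `γ` of the component orthogonal to `ν`. -/
structure IsBoundedLipschitzDomain {d : ℕ} (D : Set (EuclideanSpace ℝ (Fin d))) : Prop where
  isOpen : IsOpen D
  isConnected : IsConnected D
  isBounded : Bornology.IsBounded D
  lipschitz_boundary : ∀ x ∈ frontier D,
    ∃ (ν : EuclideanSpace ℝ (Fin d)) (γ : EuclideanSpace ℝ (Fin d) → ℝ) (K : ℝ≥0) (ρ : ℝ),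
      ‖ν‖ = 1 ∧ LipschitzWith K γ ∧ 0 < ρ ∧
      ∀ y ∈ Metric.ball x ρ, y ∈ D ↔ γ (y - ⟪ν, y⟫ • ν) < ⟪ν, y⟫

/-- The real Hilbert space `L²(D)`. -/
abbrev L2 {d : ℕ} (D : Set (EuclideanSpace ℝ (Fin d))) : Type :=
  Lp ℝ 2 ((volume : Measure (EuclideanSpace ℝ (Fin d))).restrict D)

/-- `v ∈ C_c^∞(D)`. -/
def IsTestFunction {d : ℕ} (D : Set (EuclideanSpace ℝ (Fin d)))
    (v : EuclideanSpace ℝ (Fin d) → ℝ) : Prop :=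
  ContDiff ℝ ((⊤ : ℕ∞) : WithTop ℕ∞) v ∧ HasCompactSupport v ∧ tsupport v ⊆ D

/-- `w ∈ H¹₀(D)` with weak gradient `G`: the pair `(w, G)` is an `L²`-limit of pairs `(v, ∇v)`
with `v ∈ C_c^∞(D)`. -/
def HasH10Gradient {d : ℕ} (D : Set (EuclideanSpace ℝ (Fin d))) (w : L2 D)
    (G : Lp (EuclideanSpace ℝ (Fin d)) 2
      ((volume : Measure (EuclideanSpace ℝ (Fin d))).restrict D)) : Prop :=
  ∃ v : ℕ → EuclideanSpace ℝ (Fin d) → ℝ,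
    (∀ n, IsTestFunction D (v n)) ∧
    Tendsto (fun n => eLpNorm (fun x => v n x - w x) 2 (volume.restrict D)) atTop (𝓝 0) ∧
    Tendsto (fun n => eLpNorm (fun x => gradient (v n) x - G x) 2 (volume.restrict D))
      atTop (𝓝 0)

/-- `-Δ w = lam w` in `D`, `w = 0` on `∂D`, in the weak sense: `w ∈ H¹₀(D)` and
`∫_D ∇w · ∇v = lam ∫_D w v` for all `v ∈ C_c^∞(D)`. -/
def SolvesDirichletEigenproblem {d : ℕ} (D : Set (EuclideanSpace ℝ (Fin d)))
    (lam : ℝ) (w : L2 D) : Prop :=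
  ∃ G, HasH10Gradient D w G ∧ ∀ v, IsTestFunction D v →
    ∫ x in D, ⟪G x, gradient v x⟫ = lam * ∫ x in D, w x * v x

/-- The nondecreasing Dirichlet eigenvalues `lam` of `-Δ` on `D`, counted with multiplicity, and an
orthonormal basis `φ` of `L²(D)` of corresponding eigenfunctions (numbered from `0`). -/
structure IsDirichletEigensystem {d : ℕ} (D : Set (EuclideanSpace ℝ (Fin d)))
    (lam : ℕ → ℝ) (φ : HilbertBasis ℕ ℝ (L2 D)) : Prop where
  monotone : Monotone lam
  eigen : ∀ k, SolvesDirichletEigenproblem D (lam k) (φ k)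

/-- The two-parameter Mittag-Leffler function `E_{α,β}` on the real line. -/
def mittagLeffler (α β z : ℝ) : ℝ := ∑' k : ℕ, z ^ k / Real.Gamma (k * α + β)

/-- The solution operator `E(τ)v = ∑ₖ E_{α,1}(-λₖ^s τ^α) (v, φₖ) φₖ` on `L²(D)`. -/
def solutionOp {d : ℕ} {D : Set (EuclideanSpace ℝ (Fin d))} (α s : ℝ) (lam : ℕ → ℝ)
    (φ : HilbertBasis ℕ ℝ (L2 D)) (τ : ℝ) (v : L2 D) : L2 D :=
  ∑' k : ℕ, (mittagLeffler α 1 (-(lam k ^ s) * τ ^ α) * ⟪v, φ k⟫) • φ k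

/-- Fractional Brownian motion with Hurst index `H`: a centred Gaussian process with covariance
`(s^{2H} + t^{2H} - |t - s|^{2H}) / 2`. -/
structure IsFractionalBrownianMotion {Ω : Type*} [MeasurableSpace Ω] (μ : Measure Ω) (H : ℝ)
    (W : ℝ≥0 → Ω → ℝ) : Prop where
  gaussian : IsGaussianProcess W μ
  centred : ∀ t, ∫ ω, W t ω ∂μ = 0
  covariance_eq : ∀ s t : ℝ≥0, cov[W s, W t; μ] =
    ((s : ℝ) ^ (2 * H) + (t : ℝ) ^ (2 * H) - |(t : ℝ) - (s : ℝ)| ^ (2 * H)) / 2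

/-- Data of a `K`-valued step function `∑ᵢ 1_{(aᵢ, bᵢ]} vᵢ` on `[0, t]`. -/
structure StepData (K : Type*) (t : ℝ) where
  n : ℕ
  a : Fin n → ℝ≥0
  b : Fin n → ℝ≥0
  v : Fin n → K
  a_le_b : ∀ i, a i ≤ b i
  b_le : ∀ i, (b i : ℝ) ≤ t

/-- The step function `∑ᵢ 1_{(aᵢ, bᵢ]} vᵢ`. -/
def StepData.toFun {K : Type*} [AddCommMonoid K] {t : ℝ} (p : StepData K t) (r : ℝ) : K :=
  ∑ i, (Set.Ioc (p.a i : ℝ) (p.b i : ℝ)).indicator (fun _ => p.v i) r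

/-- The elementary integral `∑ᵢ (W(bᵢ) - W(aᵢ)) vᵢ` of a step function. -/
def StepData.integral {K : Type*} [AddCommMonoid K] [Module ℝ K] {t : ℝ} (p : StepData K t)
    {Ω : Type*} (W : ℝ≥0 → Ω → ℝ) (ω : Ω) : K :=
  ∑ i, (W (p.b i) ω - W (p.a i) ω) • p.v i

/-- `X = ∫₀ᵗ q(r) dW(r)`, the Wiener integral of a deterministic Hilbert-space valued integrand:
the closure of the elementary integral, as an operator from `L²(0, t; K)` to `L²(Ω; K)`. For
fractional Brownian motion the elementary integral is closable for every `H ∈ (0,1)`, so `X` is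
almost surely determined by `q`; if `H ≥ 1/2` every `q ∈ L²` is integrable, and if `H < 1/2` every
`q` of the fractional Sobolev class of order `1/2 - H` is. -/
def IsWienerIntegral {Ω : Type*} [MeasurableSpace Ω] (μ : Measure Ω) (W : ℝ≥0 → Ω → ℝ)
    {K : Type*} [NormedAddCommGroup K] [InnerProductSpace ℝ K] (t : ℝ) (q : ℝ → K)
    (X : Ω → K) : Prop :=
  MemLp q 2 (volume.restrict (Set.Ioc 0 t)) ∧ MemLp X 2 μ ∧
  ∃ p : ℕ → StepData K t,
    Tendsto (fun n => eLpNorm (fun r => (p n).toFun r - q r) 2 (volume.restrict (Set.Ioc 0 t)))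
      atTop (𝓝 0) ∧
    Tendsto (fun n => eLpNorm (fun ω => (p n).integral W ω - X ω) 2 μ) atTop (𝓝 0)

/-- The mild solution on `[0, T]` of
`∂ₜ u + ∂ₜ^{1-α} A^s u = f(x) h(t) + g(x) Ẇ(t)`, `u(0) = 0`, `u = 0` on `∂D`: for every `t`,
`u(t) = ∫₀ᵗ h(r) E(t-r) f dr + ∫₀ᵗ E(t-r) g dW(r)` almost surely. -/
def IsMildSolution {d : ℕ} {D : Set (EuclideanSpace ℝ (Fin d))} (α s T : ℝ) (lam : ℕ → ℝ)
    (φ : HilbertBasis ℕ ℝ (L2 D)) (h : ℝ → ℝ) {Ω : Type*} [MeasurableSpace Ω] (μ : Measure Ω)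
    (W : ℝ≥0 → Ω → ℝ) (f g : L2 D) (u : ℝ → Ω → L2 D) : Prop :=
  ∀ t ∈ Set.Icc 0 T, ∃ X : Ω → L2 D,
    IsWienerIntegral μ W t (fun r => solutionOp α s lam φ (t - r) g) X ∧
    ∀ᵐ ω ∂μ, u t ω = (∫ r in (0 : ℝ)..t, h r • solutionOp α s lam φ (t - r) f) + X ω

/-- The spectral coefficient `uₖ(t) = (u(t), φₖ)`, a real random variable. -/
def spectralCoeff {d : ℕ} {D : Set (EuclideanSpace ℝ (Fin d))} (φ : HilbertBasis ℕ ℝ (L2 D))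
    {Ω : Type*} (u : ℝ → Ω → L2 D) (k : ℕ) (t : ℝ) (ω : Ω) : ℝ :=
  ⟪u t ω, φ k⟫

end

/-! Testing the mild solution at time `T` with the eigenfunctions separates the problem. The mean of
the `k`-th coefficient is `(f, φₖ)` times `∫ h mₖ`, where `mₖ(r) = E_{α,1}(-λₖ^s (T - r)^α)`. The
covariance of coefficients `k` and `l` is `(g, φₖ)(g, φₗ)` times a number `cₖₗ`, formally the
covariance of `∫ mₖ dW` and `∫ mₗ dW`. If these factors are positive and do not depend on the
driving noise, the means give `f`, and the covariances give all products `(g, φₖ)(g, φₗ)`, hence `g`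
up to sign.

Positivity rests on `mₖ` being positive and nondecreasing on `[0, T]`, that is, on `E_{α,1}(-x)`
being positive and nonincreasing for `x ≥ 0`; the eigenvalues are nonnegative by the weak equation.
For `E_{α,1}`, Euler's product for `1/Γ` turns the power series into a limit of expectations of `(1
- z/n^α)^{-(Kₙ+1)}` over a Markov chain `Kₙ` (`tendsto_urnExp_mittagLeffler`). At `z = -x` the
integrand decreases in `x`, and Jensen's inequality bounds it below.

The noise is treated as a curve in a Hilbert space with the fractional covariance. An integral is
determined by its integrand (`HasFbmCov.isScalarIntegral_unique`), so any convenient approximation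
computes it. For monotone integrands dyadic Riemann sums converge for every `H > 0`; their inner
products depend only on `H`, `T` and the integrands, so `cₖₗ` is the same for both noises. Summation
by parts bounds them below by `mₖ(0) mₗ(0) T^{2H}`, although disjoint increments are negatively
correlated when `H < 1/2`. -/

/-! ### Monotonicity and positivity of the Mittag-Leffler function on the negative half-line -/

/-- The expectation of `F (Kₙ)`, where `K₀ = 0` and `Kₙ₊₁` is `Kₙ + 1` with probability
`α (Kₙ + 1) / (n + 1)` and `Kₙ` otherwise. -/
noncomputable def urnExp (α : ℝ) : ℕ → (ℕ → ℝ) → ℝ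
  | 0, F => F 0
  | n + 1, F => urnExp α n
      (fun i => (1 - α * (i + 1) / (n + 1)) * F i + α * (i + 1) / (n + 1) * F (i + 1))

/-- The transition weights lie in `[0, 1]`, because `α ≤ 1` and the chain satisfies `Kₙ ≤ n`; only
values at `i ≤ n` enter. -/
lemma urnExp_mono {α : ℝ} (h0 : 0 ≤ α) (h1 : α ≤ 1) (n : ℕ) :
    ∀ {F G : ℕ → ℝ}, (∀ i ≤ n, F i ≤ G i) → urnExp α n F ≤ urnExp α n G := by
  induction n with
  | zero => intro F G h; exact h 0 le_rfl
  | succ n ih =>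
    intro F G h
    refine ih fun i hi => ?_
    have hi' : (i : ℝ) + 1 ≤ n + 1 := by exact_mod_cast Nat.succ_le_succ hi
    have hq : α * (i + 1) / (n + 1) ≤ 1 := by
      rw [div_le_one (by positivity)]
      nlinarith
    have hq0 : 0 ≤ α * (i + 1) / (n + 1) := by positivity
    have := mul_le_mul_of_nonneg_left (h i (by omega)) (sub_nonneg.2 hq)
    have := mul_le_mul_of_nonneg_left (h (i + 1) (by omega)) hq0
    linarith

lemma urnExp_add_mul (α : ℝ) (n : ℕ) : ∀ (a b : ℝ) (F G : ℕ → ℝ),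
    urnExp α n (fun i => a * F i + b * G i) = a * urnExp α n F + b * urnExp α n G := by
  induction n with
  | zero => intro a b F G; rfl
  | succ n ih =>
    intro a b F G
    simp only [urnExp]
    rw [← ih]
    congr 1
    funext i
    ring

lemma hasSum_urnExp (α : ℝ) (n : ℕ) : ∀ {F : ℕ → ℕ → ℝ} {G : ℕ → ℝ},
    (∀ i, HasSum (fun k => F k i) (G i)) → HasSum (fun k => urnExp α n (F k)) (urnExp α n G) := by
  induction n with
  | zero => intro F G h; exact h 0
  | succ n ih =>
    intro F G h
    exact ih fun i => ((h i).mul_left _).add ((h (i + 1)).mul_left _)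

/-- The chain is built for this identity: since `C(k+i+1, i+1) = C(k+i, i)(k+i+1)/(i+1)`, step `n`
multiplies the function `i ↦ C(k+i, i)` by `1 + αk/(n+1)`. -/
lemma urnExp_choose (α : ℝ) (k n : ℕ) :
    urnExp α n (fun i => ((k + i).choose i : ℝ)) =
      ∏ i ∈ Finset.range n, (1 + α * k / (i + 1)) := by
  induction n with
  | zero => simp [urnExp]
  | succ n ih =>
    rw [Finset.prod_range_succ, ← ih]
    have h := urnExp_add_mul α n (1 + α * k / (n + 1)) 0 (fun i => ((k + i).choose i : ℝ))
      (fun i => ((k + i).choose i : ℝ))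
    rw [zero_mul, add_zero] at h
    rw [mul_comm, ← h]
    simp only [urnExp]
    congr 1
    funext i
    have hc : ((k : ℝ) + i + 1) * ((k + i).choose i : ℝ) =
        ((k + (i + 1)).choose (i + 1) : ℝ) * (i + 1) := by
      exact_mod_cast Nat.add_one_mul_choose_eq (k + i) i
    have hn : (n : ℝ) + 1 ≠ 0 := by positivity
    field_simp
    linear_combination (-α) * hc

/-- The expectation of the negative binomial series `∑ₖ C(k+i, i) r^k = (1 - r)^{-(i+1)}`. -/
lemma hasSum_prod_mul_pow (α : ℝ) (n : ℕ) {r : ℝ} (hr : |r| < 1) :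
    HasSum (fun k : ℕ => (∏ i ∈ Finset.range n, (1 + α * k / (i + 1))) * r ^ k)
      (urnExp α n (fun i => 1 / (1 - r) ^ (i + 1))) := by
  have h := hasSum_urnExp α n (F := fun k i => ((k + i).choose i : ℝ) * r ^ k)
    (fun i => hasSum_choose_mul_geometric_of_norm_lt_one i (r := r) (by simpa using hr))
  convert h using 2 with k
  rw [← urnExp_choose]
  have := urnExp_add_mul α n (r ^ k) 0 (fun i => ((k + i).choose i : ℝ)) (fun i => 0)
  simp only [mul_zero, add_zero, zero_mul] at this
  rw [mul_comm, ← this]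
  simp only [mul_comm]

/-- `Γ(n + 1 + p) / (n! n^p Γ(p + 1))` in product form. -/
noncomputable def eulerRatio (p : ℝ) (n : ℕ) : ℝ :=
  (∏ i ∈ Finset.range n, (1 + p / (i + 1))) / (n : ℝ) ^ p

lemma eulerRatio_nonneg {p : ℝ} (hp : 0 ≤ p) (n : ℕ) : 0 ≤ eulerRatio p n := by
  unfold eulerRatio; positivity

lemma tendsto_eulerRatio {p : ℝ} (hp : 0 ≤ p) :
    Tendsto (eulerRatio p) atTop (𝓝 (1 / Real.Gamma (p + 1))) := by
  rcases hp.eq_or_lt with rfl | hp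
  · simp only [zero_add, Real.Gamma_one, one_div_one]
    exact tendsto_const_nhds.congr fun n => by simp [eulerRatio]
  have h := (Real.GammaSeq_tendsto_Gamma p).const_mul p
  rw [← Real.Gamma_add_one hp.ne'] at h
  have h2 := h.inv₀ (Real.Gamma_pos_of_pos (by positivity)).ne'
  rw [one_div]
  refine h2.congr fun n => ?_
  have key : ∀ n : ℕ, ∏ j ∈ Finset.range (n + 1), (p + j) =
      p * n.factorial * ∏ i ∈ Finset.range n, (1 + p / (i + 1)) := by
    intro n
    induction n with
    | zero => simp
    | succ n ih =>
      rw [Finset.prod_range_succ, ih, Finset.prod_range_succ, Nat.factorial_succ]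
      push_cast
      field_simp
      ring
  rw [Real.GammaSeq, key, eulerRatio]
  have hf : (n.factorial : ℝ) ≠ 0 := by positivity
  have hprod : ∏ i ∈ Finset.range n, (1 + p / ((i : ℝ) + 1)) ≠ 0 :=
    (Finset.prod_pos fun i _ => by positivity).ne'
  rw [mul_div_assoc', inv_div, div_eq_div_iff_comm]
  field_simp

/-- This amounts to `1 + p/(n+1) ≤ exp (p/(n+1)) ≤ ((n+1)/n)^p`. Monotonicity in `n` provides the
dominating series for the limit `n → ∞`. -/
lemma eulerRatio_succ_le {p : ℝ} (hp : 0 ≤ p) {n : ℕ} (hn : 1 ≤ n) :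
    eulerRatio p (n + 1) ≤ eulerRatio p n := by
  have hn0 : (0 : ℝ) < n := by exact_mod_cast hn
  unfold eulerRatio
  rw [Finset.prod_range_succ]
  have hP : 0 ≤ ∏ i ∈ Finset.range n, (1 + p / ((i : ℝ) + 1)) :=
    Finset.prod_nonneg fun i _ => by positivity
  have hb : (1 + p / ((n : ℝ) + 1)) * (n : ℝ) ^ p ≤ ((n + 1 : ℕ) : ℝ) ^ p := by
    have e1 : 1 + p / ((n : ℝ) + 1) ≤ Real.exp (p / (n + 1)) := by
      linarith [Real.add_one_le_exp (p / ((n : ℝ) + 1))]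
    have e2 : (n : ℝ) / (n + 1) ≤ Real.exp (-1 / (n + 1)) := by
      have := Real.add_one_le_exp (-1 / ((n : ℝ) + 1))
      have e : -1 / ((n : ℝ) + 1) + 1 = n / (n + 1) := by field_simp; ring
      rwa [e] at this
    have e3 : (n : ℝ) ^ p ≤ Real.exp (-(p / (n + 1))) * ((n : ℝ) + 1) ^ p := by
      have := Real.rpow_le_rpow (by positivity) e2 hp
      rw [Real.div_rpow hn0.le (by positivity), div_le_iff₀ (by positivity), ← Real.exp_mul] at this
      refine this.trans_eq ?_
      congr 2
      ring
    calc (1 + p / ((n : ℝ) + 1)) * (n : ℝ) ^ p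
        ≤ Real.exp (p / (n + 1)) * (Real.exp (-(p / (n + 1))) * ((n : ℝ) + 1) ^ p) := by
          gcongr
      _ = ((n + 1 : ℕ) : ℝ) ^ p := by
          rw [← mul_assoc, ← Real.exp_add]; simp
  rw [div_le_div_iff₀ (by positivity) (by positivity), mul_assoc]
  exact mul_le_mul_of_nonneg_left hb hP

lemma eulerRatio_le {p : ℝ} (hp : 0 ≤ p) {m n : ℕ} (hm : 1 ≤ m) (hmn : m ≤ n) :
    eulerRatio p n ≤ eulerRatio p m := by
  induction n, hmn using Nat.le_induction with
  | base => rfl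
  | succ n h ih => exact (eulerRatio_succ_le hp (hm.trans h)).trans ih

lemma exists_nat_abs_div_rpow_lt_one {α : ℝ} (hα : 0 < α) (z : ℝ) :
    ∃ m : ℕ, 1 ≤ m ∧ ∀ n ≥ m, |z / (n : ℝ) ^ α| < 1 := by
  have h : Tendsto (fun n : ℕ => |z / (n : ℝ) ^ α|) atTop (𝓝 0) := by
    have := ((tendsto_rpow_atTop hα).comp tendsto_natCast_atTop_atTop).const_div_atTop z
    simpa using this.abs
  obtain ⟨m, hm⟩ := eventually_atTop.1 (h.eventually_lt_const one_pos)
  exact ⟨max m 1, le_max_right _ _, fun n hn => hm n ((le_max_left _ _).trans hn)⟩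

lemma eulerRatio_mul_pow {α : ℝ} (z : ℝ) (n k : ℕ) :
    (∏ i ∈ Finset.range n, (1 + α * k / (i + 1))) * (z / (n : ℝ) ^ α) ^ k =
      z ^ k * eulerRatio (α * k) n := by
  rw [eulerRatio, Real.rpow_mul_natCast (Nat.cast_nonneg n), div_pow]
  ring

/-- A dominating series for the Mittag-Leffler series, uniform on bounded sets. -/
lemma exists_eulerRatio_summable {α : ℝ} (hα : 0 < α) (z : ℝ) :
    ∃ m : ℕ, 1 ≤ m ∧ (∀ n ≥ m, |z / (n : ℝ) ^ α| < 1) ∧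
      Summable (fun k : ℕ => |z| ^ k * eulerRatio (α * k) m) := by
  obtain ⟨m, hm1, hm⟩ := exists_nat_abs_div_rpow_lt_one hα z
  refine ⟨m, hm1, hm, ?_⟩
  have hr : |(|z| / (m : ℝ) ^ α)| < 1 := by
    have := hm m le_rfl
    rw [abs_div] at this ⊢
    rw [abs_abs]
    exact this
  refine (hasSum_prod_mul_pow α m hr).summable.congr fun k => ?_
  exact eulerRatio_mul_pow _ _ _

/-- With `r = z/n^α` the series for the expectation has terms `z^k · eulerRatio (α k) n`, which tend
to `z^k / Γ(αk + 1)` and are dominated by their values at a fixed `n = m`. -/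
lemma tendsto_urnExp_mittagLeffler {α : ℝ} (hα : 0 < α) (z : ℝ) :
    Tendsto (fun n : ℕ => urnExp α n (fun i => 1 / (1 - z / (n : ℝ) ^ α) ^ (i + 1))) atTop
      (𝓝 (mittagLeffler α 1 z)) := by
  obtain ⟨m, hm1, hm, hsum⟩ := exists_eulerRatio_summable hα z
  have hlim := tendsto_tsum_of_dominated_convergence
    (f := fun (n : ℕ) (k : ℕ) => z ^ k * eulerRatio (α * k) n)
    (g := fun k : ℕ => z ^ k / Real.Gamma (k * α + 1)) (𝓕 := atTop) hsum
    (fun k => by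
      have := (tendsto_eulerRatio (p := α * k) (by positivity)).const_mul (z ^ k)
      rwa [mul_one_div, show Real.Gamma (α * k + 1) = Real.Gamma (k * α + 1) by rw [mul_comm]]
        at this)
    (by
      filter_upwards [eventually_ge_atTop m] with n hn k
      rw [norm_mul, norm_pow, Real.norm_eq_abs, Real.norm_eq_abs,
        abs_of_nonneg (eulerRatio_nonneg (by positivity) n)]
      exact mul_le_mul_of_nonneg_left (eulerRatio_le (by positivity) hm1 hn) (by positivity))
  refine hlim.congr' ?_
  filter_upwards [eventually_ge_atTop m] with n hn
  rw [← (hasSum_prod_mul_pow α n (hm n hn)).tsum_eq]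
  exact tsum_congr fun k => (eulerRatio_mul_pow _ _ _).symm

lemma one_div_one_add_div_pow_le {α x y : ℝ} (hx : 0 ≤ x) (hxy : x ≤ y) (n i : ℕ) :
    1 / (1 - -y / (n : ℝ) ^ α) ^ (i + 1) ≤ 1 / (1 - -x / (n : ℝ) ^ α) ^ (i + 1) := by
  simp only [neg_div, sub_neg_eq_add]
  gcongr

lemma mittagLeffler_neg_le {α : ℝ} (hα : 0 < α) (hα1 : α ≤ 1) {x y : ℝ} (hx : 0 ≤ x)
    (hxy : x ≤ y) : mittagLeffler α 1 (-y) ≤ mittagLeffler α 1 (-x) :=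
  le_of_tendsto_of_tendsto' (tendsto_urnExp_mittagLeffler hα (-y))
    (tendsto_urnExp_mittagLeffler hα (-x)) fun n =>
      urnExp_mono hα.le hα1 n fun i _ => one_div_one_add_div_pow_le hx hxy n i

lemma mittagLeffler_zero (α : ℝ) : mittagLeffler α 1 0 = 1 := by
  rw [mittagLeffler, tsum_eq_single 0 (by intro k hk; simp [hk])]
  simp [Real.Gamma_one]

/-- Jensen's inequality for the chain: `(1+y)^{-(K+1)} ≥ exp(-y(K+1))` with `y = x/n^α`, and the
mean of `K + 1` is the product `M`. -/
lemma exp_le_mittagLeffler_neg {α : ℝ} (hα : 0 < α) (hα1 : α ≤ 1) {x : ℝ} (hx : 0 ≤ x) :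
    Real.exp (-(x * (1 / Real.Gamma (α + 1)))) ≤ mittagLeffler α 1 (-x) := by
  have hL : Tendsto (fun n : ℕ => Real.exp (-(x * eulerRatio α n))) atTop
      (𝓝 (Real.exp (-(x * (1 / Real.Gamma (α + 1)))))) :=
    (Real.continuous_exp.tendsto _).comp ((tendsto_eulerRatio hα.le).const_mul x).neg
  refine le_of_tendsto_of_tendsto' hL (tendsto_urnExp_mittagLeffler hα (-x)) fun n => ?_
  set y : ℝ := x / (n : ℝ) ^ α with hy
  have hy0 : 0 ≤ y := by positivity
  set M : ℝ := ∏ i ∈ Finset.range n, (1 + α / ((i : ℝ) + 1)) with hM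
  have hyM : x * eulerRatio α n = y * M := by rw [eulerRatio, hy]; ring
  have h0 : urnExp α n (fun _ => 1) = 1 := by simpa using urnExp_choose α 0 n
  have h1 : urnExp α n (fun i => (i : ℝ) + 1) = M := by
    simpa [Nat.choose_succ_self_right, add_comm 1] using urnExp_choose α 1 n
  -- The affine function here is the tangent to `exp(-y t)` at the mean `t = M`, evaluated at `t = i
  -- + 1`; its expectation is `exp(-y M)`.
  have h2 := urnExp_add_mul α n (Real.exp (-(y * M)) * (1 + y * M)) (-(Real.exp (-(y * M)) * y))
    (fun _ => 1) (fun i => (i : ℝ) + 1)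
  rw [h0, h1] at h2
  have h3 : Real.exp (-(y * M)) = urnExp α n (fun i => Real.exp (-(y * M)) * (1 + y * M) * 1 +
      -(Real.exp (-(y * M)) * y) * ((i : ℝ) + 1)) := by rw [h2]; ring
  rw [hyM, h3]
  refine urnExp_mono hα.le hα1 n fun i _ => ?_
  have e1 : Real.exp (-(y * M)) * (1 + y * M - y * (i + 1)) ≤ Real.exp (-(y * (i + 1))) := by
    have h4 := Real.add_one_le_exp (y * M - y * (i + 1))
    calc Real.exp (-(y * M)) * (1 + y * M - y * (i + 1))
        ≤ Real.exp (-(y * M)) * Real.exp (y * M - y * (i + 1)) :=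
          mul_le_mul_of_nonneg_left (by linarith) (Real.exp_pos _).le
      _ = _ := by rw [← Real.exp_add]; congr 1; ring
  have e2 : Real.exp (-(y * (i + 1))) ≤ 1 / (1 - -x / (n : ℝ) ^ α) ^ (i + 1) := by
    rw [neg_div, sub_neg_eq_add, ← hy, Real.exp_neg, ← one_div]
    have h5 : (1 + y) ^ (i + 1) ≤ Real.exp (y * (i + 1)) := by
      have := pow_le_pow_left₀ (by positivity) (add_comm y 1 ▸ Real.add_one_le_exp y) (i + 1)
      rwa [← Real.exp_nat_mul, mul_comm, Nat.cast_succ] at this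
    gcongr
  calc _ = Real.exp (-(y * M)) * (1 + y * M - y * (i + 1)) := by ring
    _ ≤ _ := e1.trans e2

lemma mittagLeffler_neg_pos {α : ℝ} (hα : 0 < α) (hα1 : α ≤ 1) {x : ℝ} (hx : 0 ≤ x) :
    0 < mittagLeffler α 1 (-x) :=
  (Real.exp_pos _).trans_le (exp_le_mittagLeffler_neg hα hα1 hx)

lemma one_div_Gamma_le_eulerRatio {p : ℝ} (hp : 0 ≤ p) {m : ℕ} (hm : 1 ≤ m) :
    1 / Real.Gamma (p + 1) ≤ eulerRatio p m :=
  le_of_tendsto (tendsto_eulerRatio hp)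
    ((eventually_ge_atTop m).mono fun _ hn => eulerRatio_le hp hm hn)

lemma continuous_mittagLeffler {α : ℝ} (hα : 0 < α) : Continuous (mittagLeffler α 1) := by
  refine continuous_iff_continuousAt.2 fun z => ?_
  obtain ⟨m, hm1, -, hsum⟩ := exists_eulerRatio_summable hα (|z| + 1)
  refine ContinuousOn.continuousAt (s := Metric.ball z 1) ?_ (Metric.ball_mem_nhds z one_pos)
  refine continuousOn_tsum (fun k => by fun_prop) hsum fun k y hy => ?_
  have hy1 : |y| ≤ |(|z| + 1)| := by
    rw [Metric.mem_ball, Real.dist_eq] at hy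
    rw [abs_of_nonneg (show (0 : ℝ) ≤ |z| + 1 by positivity)]
    linarith [abs_sub_abs_le_abs_sub y z]
  have hG : 0 < Real.Gamma (k * α + 1) := Real.Gamma_pos_of_pos (by positivity)
  rw [norm_div, norm_pow, Real.norm_eq_abs, Real.norm_of_nonneg hG.le, ← mul_one_div, mul_comm _ α]
  exact mul_le_mul (pow_le_pow_left₀ (abs_nonneg _) hy1 k)
    (one_div_Gamma_le_eulerRatio (by positivity) hm1) (by rw [mul_comm]; positivity) (by positivity)

/-- The relaxation function `r ↦ E_{α,1}(-c (T - r)^α)`. -/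
noncomputable def relaxation (α c T r : ℝ) : ℝ := mittagLeffler α 1 (-c * (T - r) ^ α)

lemma relaxation_monotoneOn {α : ℝ} (hα : α ∈ Set.Ioo (0 : ℝ) 1) {c : ℝ} (hc : 0 ≤ c) (T : ℝ) :
    MonotoneOn (relaxation α c T) (Set.Iic T) := by
  intro r hr t ht hrt
  simp only [Set.mem_Iic] at hr ht
  unfold relaxation
  rw [neg_mul, neg_mul]
  have ht' : 0 ≤ T - t := by linarith
  exact mittagLeffler_neg_le hα.1 hα.2.le (by positivity)
    (mul_le_mul_of_nonneg_left (Real.rpow_le_rpow ht' (by linarith) hα.1.le) hc)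

lemma relaxation_pos {α : ℝ} (hα : α ∈ Set.Ioo (0 : ℝ) 1) {c : ℝ} (hc : 0 ≤ c) {T r : ℝ}
    (hr : r ≤ T) : 0 < relaxation α c T r := by
  have : 0 ≤ T - r := by linarith
  rw [relaxation, neg_mul]
  exact mittagLeffler_neg_pos hα.1 hα.2.le (by positivity)

lemma relaxation_le_one {α : ℝ} (hα : α ∈ Set.Ioo (0 : ℝ) 1) {c : ℝ} (hc : 0 ≤ c) {T r : ℝ}
    (hr : r ≤ T) : relaxation α c T r ≤ 1 := by
  have := relaxation_monotoneOn hα hc T hr (Set.mem_Iic.2 le_rfl) hr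
  refine this.trans_eq ?_
  simp [relaxation, Real.zero_rpow hα.1.ne', mittagLeffler_zero]

lemma continuous_relaxation {α : ℝ} (hα : 0 < α) (c T : ℝ) : Continuous (relaxation α c T) :=
  (continuous_mittagLeffler hα).comp (continuous_const.mul
    ((continuous_const.sub continuous_id).rpow_const fun _ => Or.inr hα.le))

/-! ### Wiener integrals of scalar functions, in a Hilbert space -/

section WienerIntegral

variable {E : Type*} [NormedAddCommGroup E] [InnerProductSpace ℝ E]

/-- The covariance of fractional Brownian motion. -/
noncomputable def fbmCov (H s t : ℝ) : ℝ := (s ^ (2 * H) + t ^ (2 * H) - |t - s| ^ (2 * H)) / 2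

/-- A curve in a Hilbert space with the covariance of fractional Brownian motion. -/
def HasFbmCov (H : ℝ) (w : ℝ≥0 → E) : Prop := ∀ s t : ℝ≥0, ⟪w s, w t⟫ = fbmCov H s t

/-- The elementary integral of a real step function. -/
noncomputable def StepData.sum {T : ℝ} (p : StepData ℝ T) (w : ℝ≥0 → E) : E :=
  ∑ i, p.v i • (w (p.b i) - w (p.a i))

/-- `Y = ∫₀ᵀ q dw`, in the sense of the closure of the elementary integral. -/
def IsScalarIntegral (w : ℝ≥0 → E) (T : ℝ) (q : ℝ → ℝ) (Y : E) : Prop :=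
  ∃ p : ℕ → StepData ℝ T,
    Tendsto (fun n => eLpNorm (fun r => (p n).toFun r - q r) 2 (volume.restrict (Set.Ioc 0 T)))
      atTop (𝓝 0) ∧ Tendsto (fun n => (p n).sum w) atTop (𝓝 Y)

lemma HasFbmCov.inner_sub_sub {H : ℝ} {w : ℝ≥0 → E} (hw : HasFbmCov H w) (a b s t : ℝ≥0) :
    ⟪w b - w a, w t - w s⟫ = (|(s : ℝ) - b| ^ (2 * H) + |(t : ℝ) - a| ^ (2 * H)
      - |(t : ℝ) - b| ^ (2 * H) - |(s : ℝ) - a| ^ (2 * H)) / 2 := by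
  simp only [inner_sub_left, inner_sub_right, hw _ _, fbmCov]
  ring

lemma HasFbmCov.norm_sub {H : ℝ} (hH : 0 < H) {w : ℝ≥0 → E} (hw : HasFbmCov H w) (s t : ℝ≥0) :
    ‖w t - w s‖ = |(t : ℝ) - s| ^ H := by
  have h := hw.inner_sub_sub s t s t
  rw [real_inner_self_eq_norm_sq, sub_self, sub_self, abs_zero, Real.zero_rpow (by positivity),
    abs_sub_comm (s : ℝ) t] at h
  have h2 : |(t : ℝ) - s| ^ (2 * H) = (|(t : ℝ) - s| ^ H) ^ 2 := by
    rw [mul_comm, Real.rpow_mul (abs_nonneg _)]; norm_cast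
  rw [h2] at h
  refine (sq_eq_sq₀ (norm_nonneg _) (by positivity)).1 ?_
  linarith

lemma HasFbmCov.apply_zero {H : ℝ} (hH : 0 < H) {w : ℝ≥0 → E} (hw : HasFbmCov H w) : w 0 = 0 := by
  have h := hw 0 0
  rw [real_inner_self_eq_norm_sq] at h
  simpa [fbmCov, Real.zero_rpow (mul_pos two_pos hH).ne'] using h

lemma HasFbmCov.continuous {H : ℝ} (hH : 0 < H) {w : ℝ≥0 → E} (hw : HasFbmCov H w) :
    Continuous w := by
  refine continuous_iff_continuousAt.2 fun s => tendsto_iff_norm_sub_tendsto_zero.2 ?_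
  simp only [hw.norm_sub hH]
  have : Continuous fun t : ℝ≥0 => |(t : ℝ) - s| ^ H :=
    (by fun_prop : Continuous fun t : ℝ≥0 => |(t : ℝ) - s|).rpow_const fun _ => Or.inr hH.le
  have h := this.tendsto s
  rwa [sub_self, abs_zero, Real.zero_rpow hH.ne'] at h

/-- The `L²`-density representing the pairing with a difference of mean values of `w`. -/
noncomputable def meanDensity (H b ε x : ℝ) : ℝ :=
  (|b + ε - x| ^ (2 * H) - |b - x| ^ (2 * H) - |ε - x| ^ (2 * H) + |0 - x| ^ (2 * H)) / 2

lemma continuous_abs_rpow {H : ℝ} (hH : 0 < H) : Continuous fun x : ℝ => |x| ^ (2 * H) :=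
  continuous_abs.rpow_const fun _ => Or.inr (by positivity)

lemma continuous_meanDensity {H : ℝ} (hH : 0 < H) (b ε : ℝ) : Continuous (meanDensity H b ε) := by
  have h := fun c : ℝ => (continuous_abs_rpow hH).comp 
    (continuous_const.sub continuous_id : Continuous fun x : ℝ => c - x)
  exact ((((h (b + ε)).sub (h b)).sub (h ε)).add (h 0)).div_const 2

/-- Both windows have length `ε`, so the term in `x₂^{2H} - x₁^{2H}` cancels. Its density `x^{2H-1}`
would fail to be square integrable at `0` for small `H`; what remains has a continuous density. -/
lemma integral_fbmCov_sub {H : ℝ} (hH : 0 < H) (b ε x₁ x₂ : ℝ) :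
    (∫ t in b..b + ε, (fbmCov H x₂ t - fbmCov H x₁ t)) -
      (∫ t in (0 : ℝ)..ε, (fbmCov H x₂ t - fbmCov H x₁ t)) = ∫ x in x₁..x₂, meanDensity H b ε x := by
  have hf := continuous_abs_rpow hH
  have hi : ∀ a b : ℝ, IntervalIntegrable (fun x : ℝ => |x| ^ (2 * H)) volume a b :=
    fun a b => hf.intervalIntegrable a b
  have hl : ∀ (c a b : ℝ), IntervalIntegrable (fun x : ℝ => |x - c| ^ (2 * H)) volume a b :=
    fun c a b => (hf.comp (continuous_id.sub continuous_const)).intervalIntegrable a b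
  have hr : ∀ (c a b : ℝ), IntervalIntegrable (fun x : ℝ => |c - x| ^ (2 * H)) volume a b :=
    fun c a b => (hf.comp (continuous_const.sub continuous_id)).intervalIntegrable a b
  set F : ℝ → ℝ := fun u => ∫ x in (0 : ℝ)..u, |x| ^ (2 * H) with hF
  have hsub : ∀ a b : ℝ, ∫ x in a..b, |x| ^ (2 * H) = F b - F a := fun a b =>
    (intervalIntegral.integral_interval_sub_left (hi 0 b) (hi 0 a)).symm
  have hL : ∀ c e : ℝ, (∫ t in c..e, (fbmCov H x₂ t - fbmCov H x₁ t)) =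
      (e - c) * (x₂ ^ (2 * H) - x₁ ^ (2 * H)) / 2 +
        ((F (e - x₁) - F (c - x₁)) - (F (e - x₂) - F (c - x₂))) / 2 := by
    intro c e
    have e1 : ∀ t, fbmCov H x₂ t - fbmCov H x₁ t = (x₂ ^ (2 * H) - x₁ ^ (2 * H)) / 2 +
        (|t - x₁| ^ (2 * H) - |t - x₂| ^ (2 * H)) / 2 := fun t => by unfold fbmCov; ring
    simp only [e1]
    rw [intervalIntegral.integral_add (by simp) (((hl x₁ c e).sub (hl x₂ c e)).div_const 2),
      intervalIntegral.integral_const, intervalIntegral.integral_div,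
      intervalIntegral.integral_sub (hl x₁ c e) (hl x₂ c e),
      intervalIntegral.integral_comp_sub_right (fun x => |x| ^ (2 * H)),
      intervalIntegral.integral_comp_sub_right (fun x => |x| ^ (2 * H)), hsub, hsub, smul_eq_mul]
    ring
  have hR : ∀ c : ℝ, ∫ x in x₁..x₂, |c - x| ^ (2 * H) = F (c - x₁) - F (c - x₂) := by
    intro c
    rw [intervalIntegral.integral_comp_sub_left (fun x => |x| ^ (2 * H)), hsub]
  unfold meanDensity
  rw [hL, hL, intervalIntegral.integral_div, intervalIntegral.integral_add
    (((hr _ _ _).sub (hr _ _ _)).sub (hr _ _ _)) (hr _ _ _), intervalIntegral.integral_sub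
    ((hr _ _ _).sub (hr _ _ _)) (hr _ _ _), intervalIntegral.integral_sub (hr _ _ _) (hr _ _ _),
    hR, hR, hR, hR]
  ring

/-- The difference of the integrals of `w` over `[b, b + ε]` and `[0, ε]`. -/
noncomputable def meanDiff (w : ℝ≥0 → E) (b ε : ℝ) : E :=
  (∫ t in b..b + ε, w t.toNNReal) - ∫ t in (0 : ℝ)..ε, w t.toNNReal

lemma inner_meanDiff [CompleteSpace E] {w : ℝ≥0 → E} (hw : Continuous w) (Y : E) (b ε : ℝ) :
    ⟪Y, meanDiff w b ε⟫ = (∫ t in b..b + ε, ⟪Y, w t.toNNReal⟫) -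
      ∫ t in (0 : ℝ)..ε, ⟪Y, w t.toNNReal⟫ := by
  have hc : Continuous fun t : ℝ => w t.toNNReal := hw.comp continuous_real_toNNReal
  have h := fun a b : ℝ =>
    (innerSL ℝ Y).intervalIntegral_comp_comm (hc.intervalIntegrable (μ := volume) a b)
  simp only [innerSL_apply_apply] at h
  rw [meanDiff, inner_sub_right, h, h]

lemma HasFbmCov.inner_sub_meanDiff [CompleteSpace E] {H : ℝ} (hH : 0 < H) {w : ℝ≥0 → E}
    (hw : HasFbmCov H w) {b ε : ℝ} (hb : 0 ≤ b) (hε : 0 ≤ ε) (x₁ x₂ : ℝ≥0) :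
    ⟪w x₂ - w x₁, meanDiff w b ε⟫ = ∫ x in (x₁ : ℝ)..x₂, meanDensity H b ε x := by
  rw [inner_meanDiff (hw.continuous hH), ← integral_fbmCov_sub hH]
  have h : ∀ c e : ℝ, 0 ≤ c → c ≤ e → ∫ t in c..e, ⟪w x₂ - w x₁, w t.toNNReal⟫ =
      ∫ t in c..e, (fbmCov H x₂ t - fbmCov H x₁ t) := by
    intro c e hc hce
    refine intervalIntegral.integral_congr fun t ht => ?_
    rw [Set.uIcc_of_le hce] at ht
    simp only [inner_sub_left, hw _ _, Real.coe_toNNReal t (hc.trans ht.1)]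
  rw [h b (b + ε) hb (by linarith), h 0 ε le_rfl hε]

lemma StepData.memLp_toFun {T : ℝ} (p : StepData ℝ T) (μ : Measure ℝ) [IsFiniteMeasure μ] :
    MemLp p.toFun 2 μ := by
  unfold StepData.toFun
  exact memLp_finsetSum _ fun i _ => (memLp_const (p.v i)).indicator measurableSet_Ioc

lemma HasFbmCov.inner_stepSum_meanDiff [CompleteSpace E] {H : ℝ} (hH : 0 < H) {w : ℝ≥0 → E}
    (hw : HasFbmCov H w) {b ε : ℝ} (hb : 0 ≤ b) (hε : 0 ≤ ε) {T : ℝ} (p : StepData ℝ T) :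
    ⟪p.sum w, meanDiff w b ε⟫ = ∫ r in Set.Ioc 0 T, p.toFun r * meanDensity H b ε r := by
  have hψ := continuous_meanDensity hH b ε
  have hint : IntegrableOn (meanDensity H b ε) (Set.Ioc 0 T) := hψ.integrableOn_Ioc
  have e : ∀ r, p.toFun r * meanDensity H b ε r = ∑ i, (Set.Ioc (p.a i : ℝ) (p.b i : ℝ)).indicator
      (fun r => p.v i * meanDensity H b ε r) r := by
    intro r
    rw [StepData.toFun, Finset.sum_mul]
    refine Finset.sum_congr rfl fun i _ => ?_
    by_cases hr : r ∈ Set.Ioc (p.a i : ℝ) (p.b i : ℝ) <;> simp [hr]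
  simp only [e]
  rw [integral_finsetSum _ fun i _ => (hint.const_mul (p.v i)).indicator measurableSet_Ioc,
    StepData.sum, sum_inner]
  refine Finset.sum_congr rfl fun i _ => ?_
  rw [real_inner_smul_left, hw.inner_sub_meanDiff hH hb hε, integral_indicator measurableSet_Ioc,
    Measure.restrict_restrict measurableSet_Ioc, integral_const_mul,
    intervalIntegral.integral_of_le (by exact_mod_cast p.a_le_b i), Set.inter_eq_left.2]
  exact Set.Ioc_subset_Ioc (p.a i).2 (p.b_le i)

lemma tendsto_integral_mul_of_tendsto_eLpNorm {X : Type*} [MeasurableSpace X] {μ : Measure X}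
    {f : ℕ → X → ℝ} {q ψ : X → ℝ} (hf : ∀ n, MemLp (f n) 2 μ) (hq : MemLp q 2 μ)
    (hψ : MemLp ψ 2 μ) (h : Tendsto (fun n => eLpNorm (fun x => f n x - q x) 2 μ) atTop (𝓝 0)) :
    Tendsto (fun n => ∫ x, f n x * ψ x ∂μ) atTop (𝓝 (∫ x, q x * ψ x ∂μ)) := by
  have key : ∀ {u : X → ℝ} (hu : MemLp u 2 μ), ∫ x, u x * ψ x ∂μ = ⟪hψ.toLp ψ, hu.toLp u⟫ := by
    intro u hu
    rw [L2.inner_def]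
    refine integral_congr_ae ?_
    filter_upwards [hψ.coeFn_toLp, hu.coeFn_toLp] with x h1 h2
    simp [h1, h2]
  simp only [key (hf _), key hq]
  have h1 : Tendsto (fun n => (hf n).toLp (f n)) atTop (𝓝 (hq.toLp q)) :=
    (Lp.tendsto_Lp_iff_tendsto_eLpNorm'' f hf q hq).2 h
  exact tendsto_const_nhds.inner h1

lemma memLp_Ioc_of_continuous {ψ : ℝ → ℝ} (hψ : Continuous ψ) (a b : ℝ) :
    MemLp ψ 2 (volume.restrict (Set.Ioc a b)) := by
  obtain ⟨C, hC⟩ := isCompact_Icc.exists_bound_of_continuousOn (s := Set.Icc a b) hψ.continuousOn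
  refine MemLp.of_bound hψ.aestronglyMeasurable C ?_
  filter_upwards [ae_restrict_mem measurableSet_Ioc] with x hx
  exact hC x (Set.Ioc_subset_Icc_self hx)

/-- Against a difference of means the elementary integral is an `L²` pairing of the integrand with a
continuous density, so this pairing survives the closure. -/
lemma HasFbmCov.inner_isScalarIntegral [CompleteSpace E] {H : ℝ} (hH : 0 < H) {w : ℝ≥0 → E}
    (hw : HasFbmCov H w) {b ε : ℝ} (hb : 0 ≤ b) (hε : 0 ≤ ε) {T : ℝ} {q : ℝ → ℝ} {Y : E}
    (hq : MemLp q 2 (volume.restrict (Set.Ioc 0 T))) (hY : IsScalarIntegral w T q Y) :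
    ⟪Y, meanDiff w b ε⟫ = ∫ r in Set.Ioc 0 T, q r * meanDensity H b ε r := by
  obtain ⟨p, hp, hpY⟩ := hY
  have hψ := memLp_Ioc_of_continuous (continuous_meanDensity hH b ε) 0 T
  have h1 := tendsto_integral_mul_of_tendsto_eLpNorm (fun n => (p n).memLp_toFun _) hq hψ hp
  simp only [← hw.inner_stepSum_meanDiff hH hb hε] at h1
  exact tendsto_nhds_unique (hpY.inner tendsto_const_nhds) h1

/-- The derivative at `ε = 0` of the pairing with the difference of means is `⟪Y, w b⟫ - ⟪Y, w 0⟫`,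
and `w 0 = 0`. -/
lemma HasFbmCov.inner_eq_zero_of_meanDiff [CompleteSpace E] {H : ℝ} (hH : 0 < H) {w : ℝ≥0 → E}
    (hw : HasFbmCov H w) {Y : E} {b : ℝ≥0} (h : ∀ ε : ℝ, 0 ≤ ε → ⟪Y, meanDiff w b ε⟫ = 0) :
    ⟪Y, w b⟫ = 0 := by
  have hc : Continuous fun t : ℝ => ⟪Y, w t.toNNReal⟫ :=
    continuous_const.inner ((hw.continuous hH).comp continuous_real_toNNReal)
  have hd : ∀ c : ℝ, HasDerivAt (fun ε : ℝ => ∫ t in c..c + ε, ⟪Y, w t.toNNReal⟫)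
      ⟪Y, w c.toNNReal⟫ 0 := by
    intro c
    have h1 := hc.integral_hasStrictDerivAt c (c + 0) |>.hasDerivAt
    have h2 := HasDerivAt.comp_const_add c 0 h1
    simpa using h2
  have h1 := (hd b).sub (hd 0)
  -- The pairing is known to vanish only for `ε ≥ 0`, so a one-sided derivative is compared.
  have h2 : HasDerivWithinAt (fun _ : ℝ => (0 : ℝ)) _ (Set.Ici 0) 0 :=
    h1.hasDerivWithinAt.congr_of_mem (fun ε hε => by
      have := h ε hε
      rw [inner_meanDiff (hw.continuous hH)] at this
      simpa using this.symm) (Set.mem_Ici.2 le_rfl)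
  have h3 := (uniqueDiffWithinAt_Ici (0 : ℝ)).eq_deriv _ h2 (hasDerivWithinAt_const _ _ _)
  simpa [hw.apply_zero hH] using h3

/-- Closability of the elementary integral: a scalar integral is determined by its integrand. -/
theorem HasFbmCov.isScalarIntegral_unique [CompleteSpace E] {H : ℝ} (hH : 0 < H) {w : ℝ≥0 → E}
    (hw : HasFbmCov H w) {T : ℝ} {q : ℝ → ℝ} {Y Z : E}
    (hq : MemLp q 2 (volume.restrict (Set.Ioc 0 T))) (hY : IsScalarIntegral w T q Y)
    (hZ : IsScalarIntegral w T q Z) : Y = Z := by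
  have hort : ∀ b : ℝ≥0, ⟪Y - Z, w b⟫ = 0 := fun b =>
    hw.inner_eq_zero_of_meanDiff hH fun ε hε => by
      rw [inner_sub_left, hw.inner_isScalarIntegral hH b.coe_nonneg hε hq hY,
        hw.inner_isScalarIntegral hH b.coe_nonneg hε hq hZ, sub_self]
  -- `Y - Z` is orthogonal to every elementary integral, hence to their limits `Y` and `Z`, hence to
  -- itself.
  have hsum : ∀ p : StepData ℝ T, ⟪Y - Z, p.sum w⟫ = 0 := fun p => by
    simp [StepData.sum, inner_sum, real_inner_smul_right, inner_sub_right, hort]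
  have hlim : ∀ V, IsScalarIntegral w T q V → ⟪Y - Z, V⟫ = 0 := by
    rintro V ⟨p, -, hp⟩
    have := tendsto_const_nhds (x := Y - Z) |>.inner (𝕜 := ℝ) hp
    simp only [hsum] at this
    exact tendsto_nhds_unique this tendsto_const_nhds
  have : ⟪Y - Z, Y - Z⟫ = 0 := by rw [inner_sub_right, hlim Y hY, hlim Z hZ, sub_self]
  exact sub_eq_zero.1 (inner_self_eq_zero.1 this)

end WienerIntegral

/-! ### Dyadic Riemann sums of monotone integrands -/

section Dyadic

variable {E : Type*} [NormedAddCommGroup E] [InnerProductSpace ℝ E]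

/-- The dyadic points `j T / 2ⁿ`. -/
noncomputable def dyadicNode (T : ℝ≥0) (n j : ℕ) : ℝ≥0 := j * T / 2 ^ n

lemma dyadicNode_mono (T : ℝ≥0) (n : ℕ) : Monotone (dyadicNode T n) := by
  intro i j hij
  unfold dyadicNode
  gcongr

lemma dyadicNode_zero (T : ℝ≥0) (n : ℕ) : dyadicNode T n 0 = 0 := by simp [dyadicNode]

lemma dyadicNode_last (T : ℝ≥0) (n : ℕ) : dyadicNode T n (2 ^ n) = T := by
  rw [dyadicNode]; push_cast; field_simp

lemma dyadicNode_succ_two_mul (T : ℝ≥0) (n j : ℕ) :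
    dyadicNode T (n + 1) (2 * j) = dyadicNode T n j := by
  simp only [dyadicNode]; push_cast; rw [pow_succ]; field_simp

lemma dyadicNode_add_one_sub (T : ℝ≥0) (n j : ℕ) :
    (dyadicNode T n (j + 1) : ℝ) - dyadicNode T n j = T / 2 ^ n := by
  simp only [dyadicNode]; push_cast; ring

lemma dyadicNode_le (T : ℝ≥0) {n j : ℕ} (hj : j ≤ 2 ^ n) : dyadicNode T n j ≤ T :=
  (dyadicNode_mono T n hj).trans_eq (dyadicNode_last T n)

/-- The left-point dyadic step function approximating `m`. -/
noncomputable def dyadicStep (T : ℝ≥0) (m : ℝ → ℝ) (n : ℕ) : StepData ℝ T where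
  n := 2 ^ n
  a j := dyadicNode T n j
  b j := dyadicNode T n (j + 1)
  v j := m (dyadicNode T n j)
  a_le_b j := dyadicNode_mono T n (Nat.le_succ _)
  b_le j := by exact_mod_cast dyadicNode_le T (Nat.succ_le_of_lt j.2)

lemma dyadicStep_sum (T : ℝ≥0) (m : ℝ → ℝ) (n : ℕ) (w : ℝ≥0 → E) :
    (dyadicStep T m n).sum w = ∑ j ∈ Finset.range (2 ^ n),
      m (dyadicNode T n j) • (w (dyadicNode T n (j + 1)) - w (dyadicNode T n j)) :=
  (Finset.sum_range fun j => m (dyadicNode T n j) •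
    (w (dyadicNode T n (j + 1)) - w (dyadicNode T n j))).symm

lemma sum_range_two_mul {M : Type*} [AddCommMonoid M] (f : ℕ → M) (N : ℕ) :
    ∑ j ∈ Finset.range (2 * N), f j = ∑ j ∈ Finset.range N, (f (2 * j) + f (2 * j + 1)) := by
  induction N with
  | zero => simp
  | succ N ih =>
    rw [Nat.mul_succ, Finset.sum_range_succ, Finset.sum_range_succ, ih, Finset.sum_range_succ,
      add_assoc]

/-- Refining a cell changes the integrand only on its right half, by the increment of `m` up to the
midpoint. -/
lemma dyadicStep_sum_succ_sub (T : ℝ≥0) (m : ℝ → ℝ) (n : ℕ) (w : ℝ≥0 → E) :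
    (dyadicStep T m (n + 1)).sum w - (dyadicStep T m n).sum w = ∑ j ∈ Finset.range (2 ^ n),
      (m (dyadicNode T (n + 1) (2 * j + 1)) - m (dyadicNode T n j)) •
        (w (dyadicNode T n (j + 1)) - w (dyadicNode T (n + 1) (2 * j + 1))) := by
  rw [dyadicStep_sum, dyadicStep_sum, pow_succ, mul_comm, sum_range_two_mul,
    ← Finset.sum_sub_distrib]
  refine Finset.sum_congr rfl fun j _ => ?_
  have e : 2 * j + 1 + 1 = 2 * (j + 1) := by ring
  simp only [e, dyadicNode_succ_two_mul]
  module

/-- The triangle inequality suffices: each noise increment has norm `(T/2^{n+1})^H`, and the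
increments of the monotone `m` sum to at most `m T - m 0`. -/
lemma HasFbmCov.norm_dyadicStep_sum_sub_le {H : ℝ} (hH : 0 < H) {w : ℝ≥0 → E}
    (hw : HasFbmCov H w) {T : ℝ≥0} {m : ℝ → ℝ} (hm : MonotoneOn m (Set.Icc 0 T)) (n : ℕ) :
    ‖(dyadicStep T m (n + 1)).sum w - (dyadicStep T m n).sum w‖ ≤
      (T / 2 ^ (n + 1) : ℝ) ^ H * (m T - m 0) := by
  have hmem : ∀ n j, j ≤ 2 ^ n → (dyadicNode T n j : ℝ) ∈ Set.Icc (0 : ℝ) T := fun n j hj =>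
    ⟨NNReal.coe_nonneg _, by exact_mod_cast dyadicNode_le T hj⟩
  have htel := Finset.sum_range_sub (fun j => m (dyadicNode T n j)) (2 ^ n)
  rw [dyadicNode_last, dyadicNode_zero, NNReal.coe_zero] at htel
  rw [dyadicStep_sum_succ_sub, ← htel, Finset.mul_sum]
  refine (norm_sum_le _ _).trans (Finset.sum_le_sum fun j hj => ?_)
  have hj : j < 2 ^ n := Finset.mem_range.1 hj
  have hj2 : 2 * j + 1 + 1 ≤ 2 ^ (n + 1) := by rw [pow_succ]; omega
  have hlo : dyadicNode T n j ≤ dyadicNode T (n + 1) (2 * j + 1) := by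
    rw [← dyadicNode_succ_two_mul]; exact dyadicNode_mono T _ (Nat.le_succ _)
  have hhi : dyadicNode T (n + 1) (2 * j + 1) ≤ dyadicNode T n (j + 1) := by
    rw [← dyadicNode_succ_two_mul T n (j + 1)]; exact dyadicNode_mono T _ (by omega)
  have h1 := hm (hmem n j hj.le) (hmem (n + 1) (2 * j + 1) (by omega)) (by exact_mod_cast hlo)
  have h2 := hm (hmem (n + 1) (2 * j + 1) (by omega)) (hmem n (j + 1) hj) (by exact_mod_cast hhi)
  have h3 : ‖w (dyadicNode T n (j + 1)) - w (dyadicNode T (n + 1) (2 * j + 1))‖ =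
      (T / 2 ^ (n + 1) : ℝ) ^ H := by
    rw [hw.norm_sub hH, ← dyadicNode_succ_two_mul T n (j + 1),
      show 2 * (j + 1) = 2 * j + 1 + 1 by ring, dyadicNode_add_one_sub, abs_of_nonneg (by positivity)]
  rw [norm_smul, h3, Real.norm_of_nonneg (sub_nonneg.2 h1), mul_comm]
  exact mul_le_mul_of_nonneg_left (by linarith) (by positivity)

lemma HasFbmCov.exists_tendsto_dyadicStep_sum [CompleteSpace E] {H : ℝ} (hH : 0 < H)
    {w : ℝ≥0 → E} (hw : HasFbmCov H w) {T : ℝ≥0} {m : ℝ → ℝ} (hm : MonotoneOn m (Set.Icc 0 T)) :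
    ∃ V, Tendsto (fun n => (dyadicStep T m n).sum w) atTop (𝓝 V) := by
  -- Successive differences decay geometrically with ratio `2^{-H} < 1`.
  refine cauchySeq_tendsto_of_complete (cauchySeq_of_le_geometric ((1 / 2 : ℝ) ^ H)
    ((T / 2 : ℝ) ^ H * (m T - m 0)) (Real.rpow_lt_one (by norm_num) (by norm_num) hH) fun n => ?_)
  rw [dist_comm, dist_eq_norm]
  refine (hw.norm_dyadicStep_sum_sub_le hH hm n).trans_eq ?_
  have : (T / 2 ^ (n + 1) : ℝ) = T / 2 * (1 / 2) ^ n := by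
    rw [pow_succ, one_div, inv_pow]; field_simp
  rw [this, Real.mul_rpow (by positivity) (by positivity), ← Real.rpow_natCast_mul (by norm_num),
    mul_comm (n : ℝ) H, Real.rpow_mul_natCast (by norm_num)]
  ring

lemma dyadicStep_toFun {T : ℝ≥0} (hT : 0 < T) (m : ℝ → ℝ) (n : ℕ) {r : ℝ}
    (hr : r ∈ Set.Ioc (0 : ℝ) T) : ∃ t ∈ Set.Icc (0 : ℝ) T,
      (dyadicStep T m n).toFun r = m t ∧ |t - r| ≤ T / 2 ^ n := by
  have hT' : (0 : ℝ) < T := hT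
  obtain ⟨hr0, hrT⟩ := hr
  -- The cells are open on the left and closed on the right, so the ceiling is the index of the
  -- right endpoint.
  obtain ⟨j, hj⟩ : ∃ j, ⌈r * 2 ^ n / T⌉₊ = j + 1 :=
    Nat.exists_eq_succ_of_ne_zero (Nat.ceil_pos.2 (by positivity)).ne'
  have hnode : ∀ i : ℕ, (dyadicNode T n i : ℝ) = i * T / 2 ^ n := fun i => by simp [dyadicNode]
  have hmem : ∀ i : ℕ, r ∈ Set.Ioc (dyadicNode T n i : ℝ) (dyadicNode T n (i + 1)) ↔ i = j := by
    intro i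
    have h1 : ⌈r * 2 ^ n / T⌉₊ = i + 1 ↔
        r ∈ Set.Ioc (dyadicNode T n i : ℝ) (dyadicNode T n (i + 1)) := by
      rw [Nat.ceil_eq_iff (by omega), hnode, hnode, Set.mem_Ioc, lt_div_iff₀ hT', div_le_iff₀ hT',
        div_lt_iff₀ (by positivity), le_div_iff₀ (by positivity)]
      simp
    rw [← h1, hj]
    omega
  have hjn : j < 2 ^ n := by
    have : ⌈r * 2 ^ n / T⌉₊ ≤ 2 ^ n := by
      rw [Nat.ceil_le, div_le_iff₀ hT']
      push_cast
      nlinarith [pow_pos (two_pos (α := ℝ)) n]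
    omega
  have hrj := (hmem j).2 rfl
  refine ⟨dyadicNode T n j, ⟨NNReal.coe_nonneg _, by exact_mod_cast dyadicNode_le T hjn.le⟩, ?_, ?_⟩
  · have h := Finset.sum_range (n := 2 ^ n) fun i => (Set.Ioc (dyadicNode T n i : ℝ)
      (dyadicNode T n (i + 1))).indicator (fun _ => m (dyadicNode T n i)) r
    refine h.symm.trans ?_
    rw [Finset.sum_eq_single j]
    · exact Set.indicator_of_mem hrj _
    · exact fun i _ hij => Set.indicator_of_notMem (fun hi => hij ((hmem i).1 hi)) _
    · exact fun hj' => absurd (Finset.mem_range.2 hjn) hj'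
  · rw [abs_sub_comm, abs_of_pos (sub_pos.2 hrj.1), ← dyadicNode_add_one_sub T n j]
    linarith [hrj.2]

lemma tendsto_eLpNorm_dyadicStep {T : ℝ≥0} (hT : 0 < T) {m : ℝ → ℝ} (hm : Continuous m) :
    Tendsto (fun n => eLpNorm (fun r => (dyadicStep T m n).toFun r - m r) 2
      (volume.restrict (Set.Ioc 0 (T : ℝ)))) atTop (𝓝 0) := by
  set μ := volume.restrict (Set.Ioc 0 (T : ℝ)) with hμ
  have huc := isCompact_Icc.uniformContinuousOn_of_continuous
    (hm.continuousOn (s := Set.Icc 0 (T : ℝ)))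
  rw [Metric.uniformContinuousOn_iff_le] at huc
  have hbound : ∀ η : ℝ, 0 < η → ∀ᶠ n in atTop,
      eLpNorm (fun r => (dyadicStep T m n).toFun r - m r) 2 μ ≤
        μ Set.univ ^ (2 : ℝ≥0∞).toReal⁻¹ * ENNReal.ofReal η := by
    intro η hη
    obtain ⟨δ, hδ, h⟩ := huc η hη
    have hlim : Tendsto (fun n : ℕ => (T : ℝ) / 2 ^ n) atTop (𝓝 0) :=
      (tendsto_pow_atTop_atTop_of_one_lt one_lt_two).const_div_atTop _
    filter_upwards [hlim.eventually_le_const hδ] with n hn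
    refine eLpNorm_le_of_ae_bound ?_
    filter_upwards [ae_restrict_mem measurableSet_Ioc] with r hr
    obtain ⟨t, ht, htm, htr⟩ := dyadicStep_toFun hT m n hr
    rw [htm]
    exact h t ht r (Set.Ioc_subset_Icc_self hr) (htr.trans hn)
  have hK : μ Set.univ ^ (2 : ℝ≥0∞).toReal⁻¹ ≠ ∞ :=
    ENNReal.rpow_ne_top_of_nonneg (by positivity) (measure_ne_top _ _)
  have hz : Tendsto (fun η : ℝ => μ Set.univ ^ (2 : ℝ≥0∞).toReal⁻¹ * ENNReal.ofReal η) (𝓝[>] 0)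
      (𝓝 0) := by
    have h := ENNReal.Tendsto.const_mul (a := μ Set.univ ^ (2 : ℝ≥0∞).toReal⁻¹)
      (ENNReal.tendsto_ofReal (tendsto_id (x := 𝓝 (0 : ℝ)))) (Or.inr hK)
    simp only [ENNReal.ofReal_zero, mul_zero] at h
    exact h.mono_left nhdsWithin_le_nhds
  refine ENNReal.tendsto_nhds_zero.2 fun ε hε => ?_
  obtain ⟨η, hη1, hη2⟩ :=
    ((ENNReal.tendsto_nhds_zero.1 hz ε hε).and self_mem_nhdsWithin).exists
  exact (hbound η hη2).mono fun n hn => hn.trans hη1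

/-- Increments ending at the same time `T` are nested, and the longer one dominates in the
covariance formula; this holds also when disjoint increments are negatively correlated. -/
lemma HasFbmCov.inner_sub_sub_nonneg {H : ℝ} (hH : 0 < H) {w : ℝ≥0 → E} (hw : HasFbmCov H w)
    {s t T : ℝ≥0} (hs : s ≤ T) (ht : t ≤ T) : 0 ≤ ⟪w T - w s, w T - w t⟫ := by
  have hs' : (s : ℝ) ≤ T := hs
  have ht' : (t : ℝ) ≤ T := ht
  have h0 : (0 : ℝ) < 2 * H := by positivity
  rw [hw.inner_sub_sub, sub_self, abs_zero, Real.zero_rpow h0.ne', sub_zero]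
  refine div_nonneg ?_ zero_le_two
  rcases le_total s t with hst | hst
  · have : |(t : ℝ) - s| ^ (2 * H) ≤ |(T : ℝ) - s| ^ (2 * H) := by
      refine Real.rpow_le_rpow (abs_nonneg _) ?_ h0.le
      rw [abs_of_nonneg (sub_nonneg.2 (by exact_mod_cast hst)), abs_of_nonneg (sub_nonneg.2 hs')]
      linarith
    have : 0 ≤ |(t : ℝ) - T| ^ (2 * H) := by positivity
    linarith
  · have : |(t : ℝ) - s| ^ (2 * H) ≤ |(t : ℝ) - T| ^ (2 * H) := by
      refine Real.rpow_le_rpow (abs_nonneg _) ?_ h0.le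
      rw [abs_sub_comm, abs_of_nonneg (sub_nonneg.2 (by exact_mod_cast hst)), abs_sub_comm,
        abs_of_nonneg (sub_nonneg.2 ht')]
      linarith
    have : 0 ≤ |(T : ℝ) - s| ^ (2 * H) := by positivity
    linarith

/-- Summation by parts leaves the terms `(m (j+1) - m j) · a (j+1) ≥ 0`. -/
lemma abel_lower_bound {m a : ℕ → ℝ} {N : ℕ} (hm : ∀ j < N, m j ≤ m (j + 1))
    (ha : ∀ j ≤ N, 0 ≤ a j) :
    m 0 * a 0 - m N * a N ≤ ∑ j ∈ Finset.range N, m j * (a j - a (j + 1)) := by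
  induction N with
  | zero => simp
  | succ N ih =>
    rw [Finset.sum_range_succ]
    have h1 := ih (fun j hj => hm j (by omega)) (fun j hj => ha j (by omega))
    have h2 := mul_le_mul_of_nonneg_right (hm N (by omega)) (ha (N + 1) le_rfl)
    linarith

/-- Abel summation with `a j = ⟪w T - w tⱼ, y⟫`, which vanishes at the last node. -/
lemma le_inner_dyadicStep_sum {T : ℝ≥0} {m : ℝ → ℝ} (hm : MonotoneOn m (Set.Icc 0 T)) (n : ℕ)
    (w : ℝ≥0 → E) {y : E} (hy : ∀ t ≤ T, 0 ≤ ⟪w T - w t, y⟫) :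
    m 0 * ⟪w T - w 0, y⟫ ≤ ⟪(dyadicStep T m n).sum w, y⟫ := by
  have hmem : ∀ j, j ≤ 2 ^ n → (dyadicNode T n j : ℝ) ∈ Set.Icc (0 : ℝ) T := fun j hj =>
    ⟨NNReal.coe_nonneg _, by exact_mod_cast dyadicNode_le T hj⟩
  have h := abel_lower_bound (m := fun j => m (dyadicNode T n j))
    (a := fun j => ⟪w T - w (dyadicNode T n j), y⟫) (N := 2 ^ n)
    (fun j hj => hm (hmem j hj.le) (hmem (j + 1) hj)
      (by exact_mod_cast dyadicNode_mono T n (Nat.le_succ j)))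
    (fun j hj => hy _ (dyadicNode_le T hj))
  simp only [dyadicNode_zero, dyadicNode_last, sub_self, inner_zero_left, mul_zero, sub_zero,
    NNReal.coe_zero] at h
  refine h.trans_eq ?_
  rw [dyadicStep_sum, sum_inner]
  refine Finset.sum_congr rfl fun j _ => ?_
  rw [real_inner_smul_left, ← inner_sub_left]
  congr 2
  abel

lemma HasFbmCov.le_inner_dyadicStep_sum_sum {H : ℝ} (hH : 0 < H) {w : ℝ≥0 → E}
    (hw : HasFbmCov H w) {T : ℝ≥0} {m m' : ℝ → ℝ} (hm : MonotoneOn m (Set.Icc 0 T))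
    (hm' : MonotoneOn m' (Set.Icc 0 T)) (h0 : 0 ≤ m 0) (h0' : 0 ≤ m' 0) (n : ℕ) :
    m 0 * m' 0 * (T : ℝ) ^ (2 * H) ≤
      ⟪(dyadicStep T m n).sum w, (dyadicStep T m' n).sum w⟫ := by
  -- The Abel bound is used twice: here in the second factor with `y = w T - w t`, then in the first
  -- with `y` the second Riemann sum, whose sign hypothesis comes from this step.
  have h1 : ∀ t ≤ T, m' 0 * ⟪w T - w 0, w T - w t⟫ ≤ ⟪w T - w t, (dyadicStep T m' n).sum w⟫ := by
    intro t ht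
    rw [real_inner_comm ((dyadicStep T m' n).sum w)]
    exact le_inner_dyadicStep_sum hm' n w fun s hs => hw.inner_sub_sub_nonneg hH hs ht
  have h2 := le_inner_dyadicStep_sum hm n w (y := (dyadicStep T m' n).sum w) fun t ht =>
    (mul_nonneg h0' (hw.inner_sub_sub_nonneg hH zero_le ht)).trans (h1 t ht)
  have h3 : ⟪w T - w 0, w T - w 0⟫ = (T : ℝ) ^ (2 * H) := by
    have h4 : (2 * H) ≠ 0 := by positivity
    rw [hw.inner_sub_sub]
    simp [Real.zero_rpow h4]
  have h4 := mul_le_mul_of_nonneg_left (h1 0 zero_le) h0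
  rw [h3] at h4
  linarith

/-- The covariance of two dyadic Riemann sums. -/
noncomputable def dyadicCov (H : ℝ) (T : ℝ≥0) (m m' : ℝ → ℝ) (n : ℕ) : ℝ :=
  ∑ i ∈ Finset.range (2 ^ n), ∑ j ∈ Finset.range (2 ^ n),
    m (dyadicNode T n i) * (m' (dyadicNode T n j) *
      ((fbmCov H (dyadicNode T n (i + 1)) (dyadicNode T n (j + 1)) -
        fbmCov H (dyadicNode T n (i + 1)) (dyadicNode T n j)) -
      (fbmCov H (dyadicNode T n i) (dyadicNode T n (j + 1)) -
        fbmCov H (dyadicNode T n i) (dyadicNode T n j))))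

/-- The right-hand side does not involve `w`; this makes the limiting covariance common to different
noises. -/
lemma HasFbmCov.inner_dyadicStep_sum {H : ℝ} {w : ℝ≥0 → E} (hw : HasFbmCov H w) (T : ℝ≥0)
    (m m' : ℝ → ℝ) (n : ℕ) :
    ⟪(dyadicStep T m n).sum w, (dyadicStep T m' n).sum w⟫ = dyadicCov H T m m' n := by
  rw [dyadicStep_sum, dyadicStep_sum, sum_inner, dyadicCov]
  refine Finset.sum_congr rfl fun i _ => ?_
  rw [inner_sum]
  refine Finset.sum_congr rfl fun j _ => ?_
  simp only [real_inner_smul_left, real_inner_smul_right, inner_sub_left, inner_sub_right, hw _ _]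
  ring

lemma IsScalarIntegral.const_mul {w : ℝ≥0 → E} {T : ℝ} {q : ℝ → ℝ} {Y : E}
    (h : IsScalarIntegral w T q Y) (c : ℝ) : IsScalarIntegral w T (fun r => c * q r) (c • Y) := by
  obtain ⟨p, hp, hY⟩ := h
  refine ⟨fun n => { p n with v := fun i => c * (p n).v i }, ?_, ?_⟩
  · have h1 := ENNReal.Tendsto.const_mul (a := ‖c‖ₑ) hp (Or.inr enorm_ne_top)
    rw [mul_zero] at h1
    refine h1.congr fun n => ?_
    rw [← eLpNorm_const_smul]
    congr 1
    funext r
    simp only [StepData.toFun, Pi.smul_apply, smul_eq_mul, mul_sub, Finset.mul_sum]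
    congr 1
    refine Finset.sum_congr rfl fun i _ => ?_
    simp only [Set.indicator_apply, mul_ite, mul_zero]
  · refine (hY.const_smul c).congr fun n => ?_
    simp [StepData.sum, Finset.smul_sum, mul_smul]

/-- The inner product of the integrals of multiples of two positive monotone functions. -/
theorem HasFbmCov.exists_inner_isScalarIntegral [CompleteSpace E] {H : ℝ} (hH : 0 < H)
    {w : ℝ≥0 → E} (hw : HasFbmCov H w) {T : ℝ≥0} (hT : 0 < T) {m m' : ℝ → ℝ} (hc : Continuous m)
    (hc' : Continuous m') (hm : MonotoneOn m (Set.Icc 0 T)) (hm' : MonotoneOn m' (Set.Icc 0 T))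
    (h0 : 0 < m 0) (h0' : 0 < m' 0) {a a' : ℝ} {Y Y' : E}
    (hY : IsScalarIntegral w T (fun r => a * m r) Y)
    (hY' : IsScalarIntegral w T (fun r => a' * m' r) Y') :
    ∃ c, 0 < c ∧ Tendsto (dyadicCov H T m m') atTop (𝓝 c) ∧ ⟪Y, Y'⟫ = a * a' * c := by
  obtain ⟨V, hV⟩ := hw.exists_tendsto_dyadicStep_sum hH hm
  obtain ⟨V', hV'⟩ := hw.exists_tendsto_dyadicStep_sum hH hm'
  have hlim : Tendsto _ atTop (𝓝 ⟪V, V'⟫) := hV.inner hV'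
  -- The approximating sequence behind `Y` is arbitrary; uniqueness replaces it by the dyadic one.
  have e : Y = a • V := hw.isScalarIntegral_unique hH
    (memLp_Ioc_of_continuous (continuous_const.mul hc) _ _) hY
    (IsScalarIntegral.const_mul ⟨_, tendsto_eLpNorm_dyadicStep hT hc, hV⟩ a)
  have e' : Y' = a' • V' := hw.isScalarIntegral_unique hH
    (memLp_Ioc_of_continuous (continuous_const.mul hc') _ _) hY'
    (IsScalarIntegral.const_mul ⟨_, tendsto_eLpNorm_dyadicStep hT hc', hV'⟩ a')
  refine ⟨⟪V, V'⟫, ?_, ?_, ?_⟩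
  · have hT' : (0 : ℝ) < T := hT
    exact lt_of_lt_of_le (by positivity) (ge_of_tendsto' hlim fun n =>
      hw.le_inner_dyadicStep_sum_sum hH hm hm' h0.le h0'.le n)
  · exact hlim.congr fun n => hw.inner_dyadicStep_sum T m m' n
  · rw [e, e', real_inner_smul_left, real_inner_smul_right]; ring

end Dyadic

/-! ### Nonnegativity of the Dirichlet eigenvalues -/

lemma IsTestFunction.memLp {d : ℕ} {D : Set (EuclideanSpace ℝ (Fin d))}
    {v : EuclideanSpace ℝ (Fin d) → ℝ} (hv : IsTestFunction D v) :
    MemLp v 2 (volume.restrict D) :=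
  (hv.1.continuous.memLp_of_hasCompactSupport hv.2.1).restrict D

lemma IsTestFunction.memLp_gradient {d : ℕ} {D : Set (EuclideanSpace ℝ (Fin d))}
    {v : EuclideanSpace ℝ (Fin d) → ℝ} (hv : IsTestFunction D v) :
    MemLp (gradient v) 2 (volume.restrict D) := by
  have hc : Continuous (gradient v) :=
    (InnerProductSpace.toDual ℝ _).symm.continuous.comp (hv.1.continuous_fderiv (by simp))
  have hs : HasCompactSupport (gradient v) :=
    (hv.2.1.fderiv ℝ).comp_left (g := (InnerProductSpace.toDual ℝ _).symm) (map_zero _)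
  exact (hc.memLp_of_hasCompactSupport hs).restrict D

/-- The weak equation is tested with the approximants `v n` of `w` itself, and `n → ∞`. -/
lemma SolvesDirichletEigenproblem.eq_norm_sq {d : ℕ} {D : Set (EuclideanSpace ℝ (Fin d))}
    {lam : ℝ} {w : L2 D} (h : SolvesDirichletEigenproblem D lam w) :
    ∃ G : Lp (EuclideanSpace ℝ (Fin d)) 2 (volume.restrict D), ‖G‖ ^ 2 = lam * ‖w‖ ^ 2 := by
  obtain ⟨G, ⟨v, hv, hvw, hvG⟩, heq⟩ := h
  refine ⟨G, ?_⟩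
  have h1 : Tendsto (fun n => (hv n).memLp.toLp (v n)) atTop (𝓝 w) :=
    (Lp.tendsto_Lp_iff_tendsto_eLpNorm' _ _).2 (hvw.congr fun n => eLpNorm_congr_ae (by
      filter_upwards [(hv n).memLp.coeFn_toLp] with x hx
      simp [hx]))
  have h2 : Tendsto (fun n => (hv n).memLp_gradient.toLp (gradient (v n))) atTop (𝓝 G) :=
    (Lp.tendsto_Lp_iff_tendsto_eLpNorm' _ _).2 (hvG.congr fun n => eLpNorm_congr_ae (by
      filter_upwards [(hv n).memLp_gradient.coeFn_toLp] with x hx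
      simp [hx]))
  have h3 : ∀ n, ⟪G, (hv n).memLp_gradient.toLp (gradient (v n))⟫ =
      lam * ⟪w, (hv n).memLp.toLp (v n)⟫ := by
    intro n
    rw [L2.inner_def, L2.inner_def]
    refine Eq.trans ?_ ((heq (v n) (hv n)).trans ?_)
    · refine integral_congr_ae ?_
      filter_upwards [(hv n).memLp_gradient.coeFn_toLp] with x hx
      rw [hx]
    · congr 1
      refine integral_congr_ae ?_
      filter_upwards [(hv n).memLp.coeFn_toLp] with x hx
      simp [hx, mul_comm]
  have h4 : Tendsto _ atTop (𝓝 ⟪G, G⟫) := tendsto_const_nhds.inner h2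
  have h5 : Tendsto _ atTop (𝓝 (lam * ⟪w, w⟫)) := (tendsto_const_nhds.inner h1).const_mul lam
  rw [← real_inner_self_eq_norm_sq, ← real_inner_self_eq_norm_sq]
  exact tendsto_nhds_unique h4 (h5.congr fun n => (h3 n).symm)

lemma IsDirichletEigensystem.nonneg {d : ℕ} {D : Set (EuclideanSpace ℝ (Fin d))} {lam : ℕ → ℝ}
    {φ : HilbertBasis ℕ ℝ (L2 D)} (hφ : IsDirichletEigensystem D lam φ) (k : ℕ) : 0 ≤ lam k := by
  obtain ⟨G, hG⟩ := (hφ.eigen k).eq_norm_sq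
  rw [φ.orthonormal.norm_eq_one k, one_pow, mul_one] at hG
  exact hG ▸ sq_nonneg _

/-! ### Coordinates of the solution operator -/

lemma HilbertBasis.hasSum_of_abs_le {K : Type*} [NormedAddCommGroup K] [InnerProductSpace ℝ K]
    (φ : HilbertBasis ℕ ℝ K) {c : ℕ → ℝ} {v : K} (hc : ∀ k, |c k| ≤ |⟪v, φ k⟫|) :
    ∃ y : K, HasSum (fun k => c k • φ k) y ∧ (∀ k, ⟪y, φ k⟫ = c k) ∧ ‖y‖ ≤ ‖v‖ := by
  have hle : ∀ k, ‖c k‖ ≤ ‖φ.repr v k‖ := fun k => by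
    rw [φ.repr_apply_apply, real_inner_comm]; exact hc k
  have hmem : Memℓp c 2 := (lp.memℓp (φ.repr v)).mono' hle
  set z : lp (fun _ : ℕ => ℝ) 2 := ⟨c, hmem⟩ with hz
  refine ⟨φ.repr.symm z, φ.hasSum_repr_symm z, fun k => ?_, ?_⟩
  · rw [real_inner_comm, ← φ.repr_apply_apply, LinearIsometryEquiv.apply_symm_apply]
  · rw [LinearIsometryEquiv.norm_map, ← φ.repr.norm_map v]
    exact lp.norm_mono two_ne_zero hle

section SolutionOperator

variable {d : ℕ} {D : Set (EuclideanSpace ℝ (Fin d))} {φ : HilbertBasis ℕ ℝ (L2 D)}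
  {lam : ℕ → ℝ} {α : ℝ}

lemma solutionOp_spec (hlam : ∀ k, 0 ≤ lam k) (hα : α ∈ Set.Ioo (0 : ℝ) 1) (s : ℝ) {T r : ℝ}
    (hr : r ≤ T) (v : L2 D) :
    HasSum (fun k => (relaxation α (lam k ^ s) T r * ⟪v, φ k⟫) • φ k)
        (solutionOp α s lam φ (T - r) v) ∧
      (∀ k, ⟪solutionOp α s lam φ (T - r) v, φ k⟫ = relaxation α (lam k ^ s) T r * ⟪v, φ k⟫) ∧
      ‖solutionOp α s lam φ (T - r) v‖ ≤ ‖v‖ := by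
  have hc : ∀ k, 0 ≤ lam k ^ s := fun k => Real.rpow_nonneg (hlam k) s
  obtain ⟨y, hy, h⟩ := φ.hasSum_of_abs_le (c := fun k => relaxation α (lam k ^ s) T r * ⟪v, φ k⟫)
    (v := v) fun k => by
      rw [abs_mul, abs_of_pos (relaxation_pos hα (hc k) hr)]
      exact mul_le_of_le_one_left (abs_nonneg _) (relaxation_le_one hα (hc k) hr)
  have he : solutionOp α s lam φ (T - r) v = y := hy.tsum_eq
  rw [he]
  exact ⟨hy, h⟩

lemma intervalIntegrable_smul_solutionOp (hlam : ∀ k, 0 ≤ lam k) (hα : α ∈ Set.Ioo (0 : ℝ) 1)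
    (s : ℝ) {T : ℝ} (hT : 0 < T) {h : ℝ → ℝ} (hh : MemLp h ∞ (volume.restrict (Set.Icc 0 T)))
    (v : L2 D) :
    IntervalIntegrable (fun r => h r • solutionOp α s lam φ (T - r) v) volume 0 T := by
  rw [intervalIntegrable_iff_integrableOn_Ioc_of_le hT.le]
  have hh' : Integrable h (volume.restrict (Set.Ioc 0 T)) :=
    (hh.mono_measure (Measure.restrict_mono Set.Ioc_subset_Icc_self le_rfl)).integrable le_top
  refine hh'.smul_bdd ‖v‖ ?_ ?_
  · refine aestronglyMeasurable_of_tendsto_ae atTop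
      (f := fun (N : ℕ) r => ∑ k ∈ Finset.range N, (relaxation α (lam k ^ s) T r * ⟪v, φ k⟫) • φ k)
      (fun N => ?_) ?_
    · refine Continuous.aestronglyMeasurable (continuous_finsetSum _ fun k _ => ?_)
      exact ((continuous_relaxation hα.1 _ T).mul continuous_const).smul continuous_const
    · filter_upwards [ae_restrict_mem measurableSet_Ioc] with r hr
      exact (solutionOp_spec hlam hα s hr.2 v).1.tendsto_sum_nat
  · filter_upwards [ae_restrict_mem measurableSet_Ioc] with r hr
    exact (solutionOp_spec hlam hα s hr.2 v).2.2

lemma inner_integral_solutionOp (hlam : ∀ k, 0 ≤ lam k) (hα : α ∈ Set.Ioo (0 : ℝ) 1)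
    (s : ℝ) {T : ℝ} (hT : 0 < T) {h : ℝ → ℝ} (hh : MemLp h ∞ (volume.restrict (Set.Icc 0 T)))
    (v : L2 D) (k : ℕ) :
    ⟪∫ r in (0 : ℝ)..T, h r • solutionOp α s lam φ (T - r) v, φ k⟫ =
      (∫ r in (0 : ℝ)..T, h r * relaxation α (lam k ^ s) T r) * ⟪v, φ k⟫ := by
  have h1 := (innerSL ℝ (φ k)).intervalIntegral_comp_comm
    (intervalIntegrable_smul_solutionOp (φ := φ) hlam hα s hT hh v)
  simp only [innerSL_apply_apply] at h1
  rw [real_inner_comm, ← h1, ← intervalIntegral.integral_mul_const]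
  refine intervalIntegral.integral_congr fun r hr => ?_
  rw [Set.uIcc_of_le hT.le] at hr
  simp only [real_inner_smul_right]
  rw [real_inner_comm, (solutionOp_spec hlam hα s hr.2 v).2.1]
  ring

end SolutionOperator

/-- The integrand is at least `Ch` times the value of the relaxation function at `0`, its minimum on
`[0, T]`. -/
lemma integral_mul_relaxation_pos {α c T Ch : ℝ} (hα : α ∈ Set.Ioo (0 : ℝ) 1) (hc : 0 ≤ c)
    (hT : 0 < T) {h : ℝ → ℝ} (hh : MemLp h ∞ (volume.restrict (Set.Icc 0 T))) (hCh : 0 < Ch)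
    (hpos : ∀ᵐ t ∂(volume.restrict (Set.Ioo 0 T)), Ch ≤ h t) :
    0 < ∫ r in (0 : ℝ)..T, h r * relaxation α c T r := by
  rw [intervalIntegral.integral_of_le hT.le, integral_Ioc_eq_integral_Ioo]
  have hh' : Integrable h (volume.restrict (Set.Ioo 0 T)) :=
    (hh.mono_measure (Measure.restrict_mono Set.Ioo_subset_Icc_self le_rfl)).integrable le_top
  have hint : Integrable (fun r => h r * relaxation α c T r) (volume.restrict (Set.Ioo 0 T)) := by
    refine hh'.mul_bdd (c := 1) (continuous_relaxation hα.1 c T).aestronglyMeasurable ?_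
    filter_upwards [ae_restrict_mem measurableSet_Ioo] with r hr
    rw [Real.norm_of_nonneg (relaxation_pos hα hc hr.2.le).le]
    exact relaxation_le_one hα hc hr.2.le
  have hm := relaxation_pos hα hc hT.le
  have hle : ∫ _r in Set.Ioo 0 T, Ch * relaxation α c T 0 ≤
      ∫ r in Set.Ioo 0 T, h r * relaxation α c T r := by
    refine integral_mono_ae (integrable_const _) hint ?_
    filter_upwards [ae_restrict_mem measurableSet_Ioo, hpos] with r hr hr'
    exact mul_le_mul hr' (relaxation_monotoneOn hα hc T hT.le hr.2.le hr.1.le) hm.le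
      (hCh.le.trans hr')
  refine lt_of_lt_of_le ?_ hle
  rw [setIntegral_const, smul_eq_mul, Real.volume_real_Ioo_of_le hT.le]
  rw [sub_zero]
  positivity

/-! ### Coordinates of Wiener integrals -/

section Probability

variable {Ω : Type*} [MeasurableSpace Ω] {μ : Measure Ω}

lemma IsFractionalBrownianMotion.memLp {H : ℝ} {W : ℝ≥0 → Ω → ℝ}
    (hW : IsFractionalBrownianMotion μ H W) (t : ℝ≥0) : MemLp (W t) 2 μ :=
  (hW.gaussian.hasGaussianLaw_eval t).memLp_two

/-- Fractional Brownian motion as a curve in `L²(Ω)`. -/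
noncomputable def IsFractionalBrownianMotion.curve {H : ℝ} {W : ℝ≥0 → Ω → ℝ}
    (hW : IsFractionalBrownianMotion μ H W) (t : ℝ≥0) : Lp ℝ 2 μ := (hW.memLp t).toLp (W t)

lemma inner_toLp_toLp {X Y : Ω → ℝ} (hX : MemLp X 2 μ) (hY : MemLp Y 2 μ) :
    ⟪hX.toLp X, hY.toLp Y⟫ = ∫ ω, X ω * Y ω ∂μ := by
  rw [L2.inner_def]
  refine integral_congr_ae ?_
  filter_upwards [hX.coeFn_toLp, hY.coeFn_toLp] with ω h1 h2
  simp [h1, h2, mul_comm]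

lemma IsFractionalBrownianMotion.hasFbmCov [IsProbabilityMeasure μ] {H : ℝ} {W : ℝ≥0 → Ω → ℝ}
    (hW : IsFractionalBrownianMotion μ H W) : HasFbmCov H hW.curve := by
  intro s t
  have h := hW.covariance_eq s t
  rw [covariance_eq_sub (hW.memLp s) (hW.memLp t), hW.centred, zero_mul, sub_zero] at h
  rw [fbmCov, ← h]
  exact inner_toLp_toLp _ _

variable {K : Type*} [NormedAddCommGroup K] [InnerProductSpace ℝ K]

lemma tendsto_eLpNorm_inner {f : ℕ → Ω → K} {q : Ω → K}
    (h : Tendsto (fun n => eLpNorm (fun x => f n x - q x) 2 μ) atTop (𝓝 0)) (e : K) :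
    Tendsto (fun n => eLpNorm (fun x => ⟪f n x, e⟫ - ⟪q x, e⟫) 2 μ) atTop (𝓝 0) := by
  have h1 := ENNReal.Tendsto.const_mul (a := ENNReal.ofReal ‖e‖) h (Or.inr ENNReal.ofReal_ne_top)
  rw [mul_zero] at h1
  refine tendsto_of_tendsto_of_tendsto_of_le_of_le tendsto_const_nhds h1 (fun _ => zero_le)
    fun n => ?_
  refine eLpNorm_le_mul_eLpNorm_of_ae_le_mul (Eventually.of_forall fun x => ?_) 2
  rw [← inner_sub_left, mul_comm]
  exact norm_inner_le_norm _ _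

/-- The real step data obtained by pairing all values with `e`. -/
noncomputable def StepData.innerConst {t : ℝ} (p : StepData K t) (e : K) : StepData ℝ t :=
  { p with v := fun i => ⟪p.v i, e⟫ }

lemma StepData.toFun_innerConst {t : ℝ} (p : StepData K t) (e : K) (r : ℝ) :
    (p.innerConst e).toFun r = ⟪p.toFun r, e⟫ := by
  simp only [StepData.toFun, StepData.innerConst, sum_inner]
  refine Finset.sum_congr rfl fun i _ => ?_
  by_cases hr : r ∈ Set.Ioc (p.a i : ℝ) (p.b i : ℝ) <;> simp [hr]

lemma StepData.inner_integral {Ω : Type*} {t : ℝ} (p : StepData K t) (e : K)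
    (W : ℝ≥0 → Ω → ℝ) (ω : Ω) :
    ⟪p.integral W ω, e⟫ = ∑ i, ⟪p.v i, e⟫ * (W (p.b i) ω - W (p.a i) ω) := by
  simp only [StepData.integral, sum_inner, real_inner_smul_left, mul_comm]

lemma IsFractionalBrownianMotion.memLp_inner_integral {H : ℝ} {W : ℝ≥0 → Ω → ℝ}
    (hW : IsFractionalBrownianMotion μ H W) {t : ℝ} (p : StepData K t) (e : K) :
    MemLp (fun ω => ⟪p.integral W ω, e⟫) 2 μ := by
  simp only [StepData.inner_integral]
  exact memLp_finsetSum _ fun i _ => ((hW.memLp _).sub (hW.memLp _)).const_mul _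

lemma IsFractionalBrownianMotion.integral_inner_integral [IsProbabilityMeasure μ] {H : ℝ}
    {W : ℝ≥0 → Ω → ℝ} (hW : IsFractionalBrownianMotion μ H W) {t : ℝ} (p : StepData K t) (e : K) :
    ∫ ω, ⟪p.integral W ω, e⟫ ∂μ = 0 := by
  have hi : ∀ t, Integrable (W t) μ := fun t => (hW.memLp t).integrable one_le_two
  simp only [StepData.inner_integral]
  refine (integral_finsetSum _ fun i _ =>
    ((hi (p.b i)).sub (hi (p.a i))).const_mul ⟪p.v i, e⟫).trans (Finset.sum_eq_zero fun i _ => ?_)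
  simp only [Pi.sub_apply]
  rw [integral_const_mul, integral_sub (hi _) (hi _), hW.centred, hW.centred, sub_zero, mul_zero]

lemma IsFractionalBrownianMotion.sum_curve {H : ℝ} {W : ℝ≥0 → Ω → ℝ}
    (hW : IsFractionalBrownianMotion μ H W) {t : ℝ} (p : StepData K t) (e : K) :
    (p.innerConst e).sum hW.curve = (hW.memLp_inner_integral p e).toLp _ := by
  refine Lp.ext (EventuallyEq.trans ?_ (hW.memLp_inner_integral p e).coeFn_toLp.symm)
  have h1 : ∀ t, hW.curve t =ᵐ[μ] W t := fun t => (hW.memLp t).coeFn_toLp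
  have h2 : ∀ i : Fin p.n, ⇑(⟪p.v i, e⟫ • (hW.curve (p.b i) - hW.curve (p.a i))) =ᵐ[μ]
      fun ω => ⟪p.v i, e⟫ * (W (p.b i) ω - W (p.a i) ω) := by
    intro i
    filter_upwards [Lp.coeFn_smul ⟪p.v i, e⟫ (hW.curve (p.b i) - hW.curve (p.a i)),
      Lp.coeFn_sub (hW.curve (p.b i)) (hW.curve (p.a i)), h1 (p.b i), h1 (p.a i)] with ω e1 e2 e3 e4
    rw [e1, Pi.smul_apply, e2, Pi.sub_apply, e3, e4, smul_eq_mul]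
  filter_upwards [Lp.coeFn_finsetSum Finset.univ
    (fun i => ⟪p.v i, e⟫ • (hW.curve (p.b i) - hW.curve (p.a i))), ae_all_iff.2 h2] with ω e1 e2
  rw [StepData.inner_integral]
  refine e1.trans ?_
  rw [Finset.sum_apply]
  exact Finset.sum_congr rfl fun i _ => e2 i

/-- Pairing with `e` is a bounded map, so it carries approximating step functions and their
integrals to scalar ones, and reduces the vector integral to the abstract scalar theory. -/
lemma IsWienerIntegral.isScalarIntegral {H : ℝ} {W : ℝ≥0 → Ω → ℝ}
    (hW : IsFractionalBrownianMotion μ H W) {t : ℝ} {q : ℝ → K} {X : Ω → K}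
    (h : IsWienerIntegral μ W t q X) (e : K) :
    IsScalarIntegral hW.curve t (fun r => ⟪q r, e⟫) ((h.2.1.inner_const e).toLp _) := by
  obtain ⟨-, hX, p, hp, hpX⟩ := h
  refine ⟨fun n => (p n).innerConst e, ?_, ?_⟩
  · simp only [StepData.toFun_innerConst]
    exact tendsto_eLpNorm_inner hp e
  · simp only [hW.sum_curve]
    exact (Lp.tendsto_Lp_iff_tendsto_eLpNorm'' _ (fun n => hW.memLp_inner_integral (p n) e) _
      (hX.inner_const e)).2 (tendsto_eLpNorm_inner hpX e)

lemma IsWienerIntegral.integral_inner_eq_zero [IsProbabilityMeasure μ] {H : ℝ} {W : ℝ≥0 → Ω → ℝ}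
    (hW : IsFractionalBrownianMotion μ H W) {t : ℝ} {q : ℝ → K} {X : Ω → K}
    (h : IsWienerIntegral μ W t q X) (e : K) : ∫ ω, ⟪X ω, e⟫ ∂μ = 0 := by
  obtain ⟨-, hX, p, -, hpX⟩ := h
  have h1 := tendsto_integral_mul_of_tendsto_eLpNorm (ψ := fun _ => (1 : ℝ))
    (fun n => hW.memLp_inner_integral (p n) e) (hX.inner_const e) (memLp_const 1)
    (tendsto_eLpNorm_inner hpX e)
  simp only [mul_one, hW.integral_inner_integral] at h1
  exact tendsto_nhds_unique h1 tendsto_const_nhds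

lemma IsWienerIntegral.integral_inner_add [IsProbabilityMeasure μ] {H : ℝ} {W : ℝ≥0 → Ω → ℝ}
    (hW : IsFractionalBrownianMotion μ H W) {t : ℝ} {q : ℝ → K} {X v : Ω → K} {F : K}
    (h : IsWienerIntegral μ W t q X) (hv : ∀ᵐ ω ∂μ, v ω = F + X ω) (e : K) :
    ∫ ω, ⟪v ω, e⟫ ∂μ = ⟪F, e⟫ := by
  have h1 : (fun ω => ⟪v ω, e⟫) =ᵐ[μ] fun ω => ⟪F, e⟫ + ⟪X ω, e⟫ := by
    filter_upwards [hv] with ω hω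
    rw [hω, inner_add_left]
  rw [integral_congr_ae h1, integral_add (integrable_const _)
    ((h.2.1.inner_const e).integrable one_le_two), h.integral_inner_eq_zero hW]
  simp

end Probability

/-! ### Moments of the spectral coefficients, and uniqueness -/

section Moments

variable {d : ℕ} {D : Set (EuclideanSpace ℝ (Fin d))} {φ : HilbertBasis ℕ ℝ (L2 D)}
  {lam : ℕ → ℝ} {α s H T : ℝ} {h : ℝ → ℝ} {Ω : Type*} [MeasurableSpace Ω] {μ : Measure Ω}
  [IsProbabilityMeasure μ] {W : ℝ≥0 → Ω → ℝ} {f g : L2 D} {u : ℝ → Ω → L2 D}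

lemma IsMildSolution.integral_spectralCoeff (hu : IsMildSolution α s T lam φ h μ W f g u)
    (hlam : ∀ k, 0 ≤ lam k) (hα : α ∈ Set.Ioo (0 : ℝ) 1) (hT : 0 < T)
    (hh : MemLp h ∞ (volume.restrict (Set.Icc 0 T))) (hW : IsFractionalBrownianMotion μ H W)
    (k : ℕ) : ∫ ω, spectralCoeff φ u k T ω ∂μ =
      (∫ r in (0 : ℝ)..T, h r * relaxation α (lam k ^ s) T r) * ⟪f, φ k⟫ := by
  obtain ⟨X, hX, hae⟩ := hu T ⟨hT.le, le_rfl⟩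
  rw [← inner_integral_solutionOp hlam hα s hT hh f k]
  exact hX.integral_inner_add hW hae (φ k)

lemma IsMildSolution.covariance_spectralCoeff (hu : IsMildSolution α s T lam φ h μ W f g u)
    (hlam : ∀ k, 0 ≤ lam k) (hα : α ∈ Set.Ioo (0 : ℝ) 1) (hH : 0 < H) (hT : 0 < T)
    (hW : IsFractionalBrownianMotion μ H W) (k l : ℕ) :
    ∃ c, 0 < c ∧ Tendsto (dyadicCov H T.toNNReal (relaxation α (lam k ^ s) T)
        (relaxation α (lam l ^ s) T)) atTop (𝓝 c) ∧
      cov[spectralCoeff φ u k T, spectralCoeff φ u l T; μ] = ⟪g, φ k⟫ * ⟪g, φ l⟫ * c := by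
  obtain ⟨X, hX, hae⟩ := hu T ⟨hT.le, le_rfl⟩
  set F := ∫ r in (0 : ℝ)..T, h r • solutionOp α s lam φ (T - r) f
  have hc : ∀ k, 0 ≤ lam k ^ s := fun k => Real.rpow_nonneg (hlam k) s
  have hXk : ∀ k, MemLp (fun ω => ⟪X ω, φ k⟫) 2 μ := fun k => hX.2.1.inner_const (φ k)
  have hmean : ∀ k, ∫ ω, spectralCoeff φ u k T ω ∂μ = ⟪F, φ k⟫ := fun k =>
    hX.integral_inner_add hW hae (φ k)
  have hcov : cov[spectralCoeff φ u k T, spectralCoeff φ u l T; μ] =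
      ⟪(hXk k).toLp _, (hXk l).toLp _⟫ := by
    rw [inner_toLp_toLp, covariance]
    refine integral_congr_ae ?_
    filter_upwards [hae] with ω hω
    rw [hmean, hmean, spectralCoeff, spectralCoeff, hω, inner_add_left, inner_add_left]
    ring
  have hTT : (T.toNNReal : ℝ) = T := Real.coe_toNNReal T hT.le
  have hint : ∀ k, IsScalarIntegral hW.curve (T.toNNReal : ℝ)
      (fun r => ⟪g, φ k⟫ * relaxation α (lam k ^ s) T r) ((hXk k).toLp _) := by
    intro k
    rw [hTT]
    obtain ⟨p, hp, hpX⟩ := hX.isScalarIntegral hW (φ k)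
    refine ⟨p, hp.congr fun n => eLpNorm_congr_ae ?_, hpX⟩
    filter_upwards [ae_restrict_mem measurableSet_Ioc] with r hr
    rw [(solutionOp_spec hlam hα s hr.2 g).2.1, mul_comm]
  have hmono : ∀ k, MonotoneOn (relaxation α (lam k ^ s) T) (Set.Icc 0 (T.toNNReal : ℝ)) :=
    fun k => (relaxation_monotoneOn hα (hc k) T).mono (by rw [hTT]; exact fun r hr => hr.2)
  rw [hcov]
  exact hW.hasFbmCov.exists_inner_isScalarIntegral hH (Real.toNNReal_pos.2 hT)
    (continuous_relaxation hα.1 _ _) (continuous_relaxation hα.1 _ _) (hmono k) (hmono l)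
    (relaxation_pos hα (hc k) hT.le) (relaxation_pos hα (hc l) hT.le) (hint k) (hint l)

end Moments

lemma HilbertBasis.eq_of_inner_eq {K : Type*} [NormedAddCommGroup K] [InnerProductSpace ℝ K]
    (φ : HilbertBasis ℕ ℝ K) {x y : K} (h : ∀ k, ⟪x, φ k⟫ = ⟪y, φ k⟫) : x = y := by
  refine φ.repr.injective (lp.ext (funext fun k => ?_))
  rw [φ.repr_apply_apply, φ.repr_apply_apply, real_inner_comm, h, real_inner_comm]

/-- A vector is determined up to sign by the pairwise products of its coordinates. -/
lemma HilbertBasis.eq_or_eq_neg_of_inner_mul_inner_eq {K : Type*} [NormedAddCommGroup K]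
    [InnerProductSpace ℝ K] (φ : HilbertBasis ℕ ℝ K) {x y : K}
    (h : ∀ k l, ⟪x, φ k⟫ * ⟪x, φ l⟫ = ⟪y, φ k⟫ * ⟪y, φ l⟫) : x = y ∨ x = -y := by
  by_cases hx : ∀ k, ⟪x, φ k⟫ = 0
  · left
    refine φ.eq_of_inner_eq fun k => ?_
    have := h k k
    rw [hx k, zero_mul, eq_comm, mul_self_eq_zero] at this
    rw [hx k, this]
  · push Not at hx
    obtain ⟨k, hk⟩ := hx
    -- The square fixes the nonzero coordinate `k` up to sign, and the products with it carry that
    -- sign to every other coordinate.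
    rcases mul_self_eq_mul_self_iff.1 (h k k) with e | e
    · left
      refine φ.eq_of_inner_eq fun l => mul_left_cancel₀ hk ?_
      rw [h k l, e]
    · right
      refine φ.eq_of_inner_eq fun l => mul_left_cancel₀ hk ?_
      rw [h k l, inner_neg_left, e]
      ring

theorem mainTheorem1 {d : ℕ} (D : Set (EuclideanSpace ℝ (Fin d)))
    (hD : IsBoundedLipschitzDomain D)
    (lam : ℕ → ℝ) (φ : HilbertBasis ℕ ℝ (L2 D)) (hφ : IsDirichletEigensystem D lam φ)
    (α s H T : ℝ) (hα : α ∈ Set.Ioo (0 : ℝ) 1) (hs : s ∈ Set.Ioo (0 : ℝ) 1)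
    (hH : H ∈ Set.Ioo (0 : ℝ) 1) (hT : 0 < T)
    (h : ℝ → ℝ) (hh : MemLp h ∞ (volume.restrict (Set.Icc 0 T)))
    (Ch : ℝ) (hCh : 0 < Ch) (hpos : ∀ᵐ t ∂(volume.restrict (Set.Ioo 0 T)), Ch ≤ h t)
    -- two problems, possibly driven by different fractional Brownian motions of the same index
    {Ω₁ Ω₂ : Type*} [MeasurableSpace Ω₁] [MeasurableSpace Ω₂]
    (μ₁ : Measure Ω₁) (μ₂ : Measure Ω₂) [IsProbabilityMeasure μ₁] [IsProbabilityMeasure μ₂]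
    (W₁ : ℝ≥0 → Ω₁ → ℝ) (W₂ : ℝ≥0 → Ω₂ → ℝ)
    (hW₁ : IsFractionalBrownianMotion μ₁ H W₁) (hW₂ : IsFractionalBrownianMotion μ₂ H W₂)
    (f₁ g₁ f₂ g₂ : L2 D) (hg₁ : g₁ ≠ 0) (hg₂ : g₂ ≠ 0)
    (u₁ : ℝ → Ω₁ → L2 D) (u₂ : ℝ → Ω₂ → L2 D)
    (hu₁ : IsMildSolution α s T lam φ h μ₁ W₁ f₁ g₁ u₁)
    (hu₂ : IsMildSolution α s T lam φ h μ₂ W₂ f₂ g₂ u₂)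
    (hmean : ∀ k, ∫ ω, spectralCoeff φ u₁ k T ω ∂μ₁ = ∫ ω, spectralCoeff φ u₂ k T ω ∂μ₂)
    (hcov : ∀ k l, cov[spectralCoeff φ u₁ k T, spectralCoeff φ u₁ l T; μ₁] =
      cov[spectralCoeff φ u₂ k T, spectralCoeff φ u₂ l T; μ₂]) :
    f₁ = f₂ ∧ (g₁ = g₂ ∨ g₁ = -g₂) := by
  have hlam := hφ.nonneg
  refine ⟨φ.eq_of_inner_eq fun k => ?_, φ.eq_or_eq_neg_of_inner_mul_inner_eq fun k l => ?_⟩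
  · have h1 := hmean k
    rw [hu₁.integral_spectralCoeff hlam hα hT hh hW₁, hu₂.integral_spectralCoeff hlam hα hT hh hW₂]
      at h1
    exact mul_left_cancel₀ (integral_mul_relaxation_pos hα (Real.rpow_nonneg (hlam k) s) hT hh hCh
      hpos).ne' h1
  · obtain ⟨c₁, hc₁, hlim₁, he₁⟩ := hu₁.covariance_spectralCoeff hlam hα hH.1 hT hW₁ k l
    obtain ⟨c₂, -, hlim₂, he₂⟩ := hu₂.covariance_spectralCoeff hlam hα hH.1 hT hW₂ k l
    have h1 := hcov k l
    -- Both constants are limits of the same sequence `dyadicCov`, so they agree and cancel.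
    rw [he₁, he₂, ← tendsto_nhds_unique hlim₁ hlim₂] at h1
    exact mul_right_cancel₀ hc₁.ne' h1
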